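/- For a set $S$, let $[S]^2$ denote the set of all unordered pairs of distinct elements of $S$. For an infinite set $F\subseteq\mathbb N=\{0,1,2,\dots\}$ put $$FS(F)=\Big\{\sum_{n\in\alpha}n:\ \alpha\subseteq F \text{ finite and non-empty}\Big\},\qquad r(F)=[F]^2,\qquad \Delta(F)=\{a-b:\ a,b\in F,\ a>b\}.$$ Let $\rho$ be one of $FS$, $r$, $\Delta$, and let $\Lambda=\mathbb N$, $[\mathbb N]^2$, $\mathbb N$, respectively. A topological space $X$ belongs to $\mathrm{FinBW}(\rho)$ if for every $f:\Lambda\to X$ there are an infinite set $F\subseteq\mathbb N$ and a point $x\in X$ such that for every neighbourhood $U$ of $x$ there is a finite set $K\subseteq\mathbb N$ with $f[\rho(F\setminus K)]\subseteq U$. The space $X$ is called a Hindman space if $X\in\mathrm{FinBW}(FS)$, a Ramsey space if $X\in\mathrm{FinBW}(r)$, and differentially compact if $X\in\mathrm{FinBW}(\Delta)$. An almost disjoint family on $\mathbb N$ is a family $\mathcal A$ of infinite subsets of $\mathbb N$ such that $A\cap B$ is finite for all distinct $A,B\in\mathcal A$. Let $\Psi(\mathcal A)$ be the disjoint union of $\mathbb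 N$ and $\mathcal A$ with the topology in which the points of $\mathbb N$ are isolated and the basic neighbourhoods of $A\in\mathcal A$ are the sets $\{A\}\cup(A\setminus F)$ with $F$ finite, and let $\Phi(\mathcal A)=\Psi(\mathcal A)\cup\{\infty\}$ be the Alexandroff one-point compactification of $\Psi(\mathcal A)$. Assume the continuum hypothesis. Then, for each of the following four items, there exists an almost disjoint family $\mathcal A$ on $\mathbb N$ (in general a different one for each item) such that $\Phi(\mathcal A)$ is a Hausdorff, compact and separable space of cardinality $\mathfrak c$ and: 1. $\Phi(\mathcal A)$ is a Ramsey space that is not a Hindman space; 2. $\Phi(\mathcal A)$ is a Hindman space that is not a Ramsey space; 3. $\Phi(\mathcal A)$ is a differentially compact space that is not a Hindman space; 4. $\Phi(\mathcal A)$ is a differentially compact space that is not a Ramsey space. -/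

import Mathlib

open Topology Cardinal

/-! ## Convergence along `ρ` and the class `FinBW(ρ)` -/

section FinBW

/-- `[ℕ]²`: the set of unordered pairs of (distinct) natural numbers. -/
abbrev NatPair : Type := {p : Finset ℕ // p.card = 2}

/-- `FS(D)`: the set of all sums of finite non-empty sets of (distinct) elements of `D`. -/
def finiteSums (D : Set ℕ) : Set ℕ :=
  {n | ∃ α : Finset ℕ, α.Nonempty ∧ (α : Set ℕ) ⊆ D ∧ n = ∑ i ∈ α, i}

/-- `r(H) = [H]²`: the set of all unordered pairs of elements of `H`. -/
def pairsOf (H : Set ℕ) : Set NatPair :=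
  {p | (p.1 : Set ℕ) ⊆ H}

/-- `Δ(E)`: the set of all positive differences of elements of `E`. -/
def positiveDifferences (E : Set ℕ) : Set ℕ :=
  {d | ∃ a ∈ E, ∃ b ∈ E, b < a ∧ d = a - b}

/-- The restriction of `f` to `ρ(F)` is `ρ`-convergent to `x`: for every neighbourhood `U` of `x`
there is a finite set `K` such that `f` maps `ρ(F \ K)` into `U`. -/
def RhoConverges {Λ X : Type*} [TopologicalSpace X] (ρ : Set ℕ → Set Λ) (F : Set ℕ)
    (f : Λ → X) (x : X) : Prop :=
  ∀ U ∈ 𝓝 x, ∃ K : Finset ℕ, f '' ρ (F \ (K : Set ℕ)) ⊆ U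

/-- `X` belongs to `FinBW(ρ)`, where `ρ` is defined on the infinite subsets of `ℕ`: for every
`f : Λ → X` there is an infinite `F ⊆ ℕ` such that the restriction of `f` to `ρ(F)` is
`ρ`-convergent to some point of `X`. -/
def FinBW {Λ : Type*} (ρ : Set ℕ → Set Λ) (X : Type*) [TopologicalSpace X] : Prop :=
  ∀ f : Λ → X, ∃ F : Set ℕ, F.Infinite ∧ ∃ x : X, RhoConverges ρ F f x

/-- Hindman spaces. -/
def IsHindmanSpace (X : Type*) [TopologicalSpace X] : Prop :=
  FinBW finiteSums X

/-- Ramsey spaces. -/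
def IsRamseySpace (X : Type*) [TopologicalSpace X] : Prop :=
  FinBW pairsOf X

/-- Differentially compact spaces. -/
def IsDifferentiallyCompact (X : Type*) [TopologicalSpace X] : Prop :=
  FinBW positiveDifferences X

end FinBW

/-! ## Almost disjoint families and the spaces `Ψ(𝒜)` and `Φ(𝒜)` -/

section Mrowka

/-- `𝒜` is an almost disjoint family on `ℕ`: its members are infinite, and any two distinct
members have finite intersection. -/
def IsAlmostDisjointFamily (𝒜 : Set (Set ℕ)) : Prop :=
  (∀ A ∈ 𝒜, A.Infinite) ∧ ∀ A ∈ 𝒜, ∀ B ∈ 𝒜, A ≠ B → (A ∩ B).Finite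

/-- The underlying set `ℕ ⊔ 𝒜` of the Mrówka space `Ψ(𝒜)`. -/
def Psi (𝒜 : Set (Set ℕ)) : Type := ℕ ⊕ 𝒜

/-- The point of `Ψ(𝒜)` given by a natural number. -/
def Psi.ofNat {𝒜 : Set (Set ℕ)} (n : ℕ) : Psi 𝒜 := Sum.inl n

/-- The point of `Ψ(𝒜)` given by a member of the family. -/
def Psi.ofMem {𝒜 : Set (Set ℕ)} (A : 𝒜) : Psi 𝒜 := Sum.inr A

/-- The topology of `Ψ(𝒜)`: the points of `ℕ` are isolated, and the basic neighbourhoods of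
`A ∈ 𝒜` are the sets `{A} ∪ (A \ F)` with `F` finite. So `U` is open iff, for every `A ∈ 𝒜` that
is a point of `U`, all but finitely many elements of `A` are points of `U`. -/
instance Psi.instTopologicalSpace (𝒜 : Set (Set ℕ)) : TopologicalSpace (Psi 𝒜) where
  IsOpen U := ∀ A : 𝒜, Psi.ofMem A ∈ U →
    ∃ F : Finset ℕ, ∀ n ∈ (A : Set ℕ) \ (F : Set ℕ), (Psi.ofNat n : Psi 𝒜) ∈ U
  isOpen_univ := fun _ _ => ⟨∅, fun _ _ => trivial⟩
  isOpen_inter := by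
    intro U V hU hV A hA
    obtain ⟨F, hF⟩ := hU A hA.1
    obtain ⟨G, hG⟩ := hV A hA.2
    refine ⟨F ∪ G, fun n hn => ⟨hF n ⟨hn.1, fun h => hn.2 ?_⟩, hG n ⟨hn.1, fun h => hn.2 ?_⟩⟩⟩
    · exact Finset.mem_coe.2 (Finset.mem_union_left _ (Finset.mem_coe.1 h))
    · exact Finset.mem_coe.2 (Finset.mem_union_right _ (Finset.mem_coe.1 h))
  isOpen_sUnion := by
    intro S hS A hA
    obtain ⟨U, hU, hAU⟩ := hA
    obtain ⟨F, hF⟩ := hS U hU A hAU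
    exact ⟨F, fun n hn => ⟨U, hU, hF n hn⟩⟩

/-- `Φ(𝒜)`: the Alexandroff one-point compactification of `Ψ(𝒜)`. -/
abbrev Phi (𝒜 : Set (Set ℕ)) : Type := OnePoint (Psi 𝒜)

/-- `𝒜` is an almost disjoint family for which `Φ(𝒜)` is a Hausdorff, compact and separable space
of cardinality `𝔠`. -/
structure IsGoodFamily (𝒜 : Set (Set ℕ)) : Prop where
  almostDisjoint : IsAlmostDisjointFamily 𝒜
  hausdorff : T2Space (Phi 𝒜)
  compact : CompactSpace (Phi 𝒜)
  separable : TopologicalSpace.SeparableSpace (Phi 𝒜)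
  card : #(Phi 𝒜) = 𝔠

end Mrowka

/-!
Call `ρ` P-regular if every `ρ(F)` lies in an ultrafilter `𝒱` such that, given countably many
members of `𝒱`, there is an infinite `E` for which each of them contains some `ρ(E \ K)` with `K`
finite. For `[·]²` such ultrafilters are the Fubini squares of nonprincipal ultrafilters, for `FS`
they are the idempotent ones. If every `g : Λ → M` maps some `ρ₁(F)` onto a set that contains no
`ρ₂(E)`, then CH allows one to construct, by recursion of length `ω₁`, an almost disjoint family of
such `ρ₂`-small sets which meets the tails of every `ρ₂(E)`, while for every `g` the image under `g`
of some `ρ₁(F)` meets only countably many of its members in an infinite set. The first property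
makes the inclusion of the isolated points into `Φ(𝒜)` a counterexample to `FinBW(ρ₂)`. By the
second, a limit `∞` along `𝒱` has to be realised against countably many members of `𝒜` only, whence
`FinBW(ρ₁)`.

For `ρ₁ = [·]²` and `ρ₂ = FS`, the image of a generic `[F]²` contains no `FS(E)` because it has a
single 2-adic valuation, or else is so thin that the elements of any given valuation are finite in
number or grow by a factor of two at each step. For `ρ₁ = FS` and `ρ₂ = [·]²`, write `g(n) =
{p n, q n}`. Along an idempotent ultrafilter each of `p` and `q` depends on a sum only through its
least term, or else essentially determines its greatest term, and neither allows all pairs of an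
infinite set to be attained. Finally, a difference is a function of a pair, and a difference of two
partial sums of a sequence is a finite sum of its terms, so both Ramsey and Hindman spaces are
differentially compact.
-/

section RhoCombinatorics

variable {Λ M : Type*} {ρ : Set ℕ → Set Λ}

/-- The filter on `Λ` generated by the sets `ρ(F \ K)` with `K` finite: `ρ`-convergence along `F`
is convergence along this filter. -/
def tailFilter (ρ : Set ℕ → Set Λ) (F : Set ℕ) : Filter Λ :=
  ⨅ K : Finset ℕ, Filter.principal (ρ (F \ K))

theorem directed_principal_sdiff (hρ : Monotone ρ) (F : Set ℕ) :
    Directed (· ≥ ·) fun K : Finset ℕ => Filter.principal (ρ (F \ K)) := by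
  classical
  exact Antitone.directed_ge fun _ _ h =>
    Filter.principal_mono.2 (hρ (Set.sdiff_subset_sdiff_right (Finset.coe_subset.2 h)))

theorem mem_tailFilter (hρ : Monotone ρ) {F : Set ℕ} {D : Set Λ} :
    D ∈ tailFilter ρ F ↔ ∃ K : Finset ℕ, ρ (F \ K) ⊆ D := by
  simp only [tailFilter, Filter.mem_iInf_of_directed (directed_principal_sdiff hρ F),
    Filter.mem_principal]

theorem tailFilter_image (hρ : Monotone ρ) (φ : Λ → M) (F : Set ℕ) :
    tailFilter (fun E => φ '' ρ E) F = (tailFilter ρ F).map φ := by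
  simp only [tailFilter, Filter.map_iInf_eq (directed_principal_sdiff hρ F), Filter.map_principal]

theorem rhoConverges_iff_tendsto (hρ : Monotone ρ) {X : Type*} [TopologicalSpace X] {F : Set ℕ}
    {f : Λ → X} {x : X} :
    RhoConverges ρ F f x ↔ Filter.Tendsto f (tailFilter ρ F) (𝓝 x) := by
  simp only [RhoConverges, Filter.Tendsto, Filter.le_def, Filter.mem_map, mem_tailFilter hρ,
    Set.image_subset_iff]

theorem FinBW.of_subset_image {ρ₂ : Set ℕ → Set M} {X : Type*} [TopologicalSpace X] (φ : Λ → M)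
    (hφ : ∀ F : Set ℕ, F.Infinite → ∃ E : Set ℕ, E.Infinite ∧
      ∀ K : Finset ℕ, ∃ L : Finset ℕ, ρ₂ (E \ L) ⊆ φ '' ρ (F \ K))
    (h : FinBW ρ X) : FinBW ρ₂ X := by
  intro f
  obtain ⟨F, hF, x, hx⟩ := h (f ∘ φ)
  obtain ⟨E, hE, hEF⟩ := hφ F hF
  refine ⟨E, hE, x, fun U hU => ?_⟩
  obtain ⟨K, hK⟩ := hx U hU
  obtain ⟨L, hL⟩ := hEF K
  exact ⟨L, (Set.image_mono hL).trans (by rwa [← Set.image_comp])⟩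

/-- `𝒱` is a `ρ`-point: every countably generated filter coarser than `𝒱` is coarser than the tail
filter of an infinite set. -/
def IsRhoPoint (ρ : Set ℕ → Set Λ) (𝒱 : Ultrafilter Λ) : Prop :=
  ∀ G : Filter Λ, G.IsCountablyGenerated → ↑𝒱 ≤ G →
    ∃ F : Set ℕ, F.Infinite ∧ tailFilter ρ F ≤ G

/-- `C` contains no set of the form `ρ(E)` with `E` infinite. -/
def RhoSmall (ρ : Set ℕ → Set Λ) (C : Set Λ) : Prop :=
  ∀ E : Set ℕ, E.Infinite → ¬ ρ E ⊆ C

/-- `ρ` is monotone, takes infinite sets to infinite sets, and its values at infinite sets belong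
to `ρ`-points. -/
structure IsPRegular (ρ : Set ℕ → Set Λ) : Prop where
  mono : Monotone ρ
  infinite : ∀ F : Set ℕ, F.Infinite → (ρ F).Infinite
  exists_point : ∀ F : Set ℕ, F.Infinite → ∃ 𝒱 : Ultrafilter Λ, ρ F ∈ 𝒱 ∧ IsRhoPoint ρ 𝒱

theorem RhoSmall.mono {C D : Set Λ} (hD : RhoSmall ρ D) (hCD : C ⊆ D) : RhoSmall ρ C :=
  fun E hE h => hD E hE (h.trans hCD)

theorem RhoSmall.image_equiv (e : Λ ≃ M) {C : Set Λ} (hC : RhoSmall ρ C) :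
    RhoSmall (fun F => e '' ρ F) (e '' C) :=
  fun E hE h => hC E hE ((Set.image_subset_image_iff e.injective).1 h)

theorem IsRhoPoint.exists_tendsto {𝒱 : Ultrafilter Λ} (h𝒱 : IsRhoPoint ρ 𝒱) {X : Type*} {f : Λ → X}
    {G : Filter X} [G.IsCountablyGenerated] (hf : Filter.Tendsto f 𝒱 G) :
    ∃ F : Set ℕ, F.Infinite ∧ Filter.Tendsto f (tailFilter ρ F) G := by
  obtain ⟨F, hF, hFG⟩ := h𝒱 (G.comap f) inferInstance (Filter.map_le_iff_le_comap.1 hf)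
  exact ⟨F, hF, Filter.map_le_iff_le_comap.2 hFG⟩

namespace IsPRegular

theorem rhoSmall_of_finite (hρ : IsPRegular ρ) {C : Set Λ} (hC : C.Finite) : RhoSmall ρ C :=
  fun E hE h => hρ.infinite E hE (hC.subset h)

theorem compl_mem_of_rhoSmall (hρ : IsPRegular ρ) {𝒱 : Ultrafilter Λ} (h𝒱 : IsRhoPoint ρ 𝒱)
    {C : Set Λ} (hC : RhoSmall ρ C) : Cᶜ ∈ 𝒱 := by
  rw [Ultrafilter.compl_mem_iff_notMem]
  intro h
  obtain ⟨F, hF, hFC⟩ := h𝒱 (Filter.principal C) inferInstance (Filter.le_principal_iff.2 h)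
  obtain ⟨K, hK⟩ := (mem_tailFilter hρ.mono).1 (Filter.le_principal_iff.1 hFC)
  exact hC _ (hF.sdiff K.finite_toSet) hK

theorem exists_mem_forall_notMem (hρ : IsPRegular ρ) {F : Set ℕ} (hF : F.Infinite) {ι : Type*}
    {s : Set ι} (hs : s.Finite) {C : ι → Set Λ} (hC : ∀ i ∈ s, RhoSmall ρ (C i)) :
    ∃ a ∈ ρ F, ∀ i ∈ s, a ∉ C i := by
  obtain ⟨𝒱, hF𝒱, h𝒱⟩ := hρ.exists_point F hF
  have hcompl : (⋂ i ∈ s, (C i)ᶜ) ∈ 𝒱 :=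
    (Filter.biInter_mem hs).2 fun i hi => hρ.compl_mem_of_rhoSmall h𝒱 (hC i hi)
  obtain ⟨a, haF, haC⟩ := 𝒱.nonempty_of_mem (Filter.inter_mem hF𝒱 hcompl)
  exact ⟨a, haF, fun i hi => Set.mem_iInter₂.1 haC i hi⟩

theorem image_equiv (hρ : IsPRegular ρ) (e : Λ ≃ M) : IsPRegular fun F => e '' ρ F where
  mono _ _ h := Set.image_mono (hρ.mono h)
  infinite F hF := (hρ.infinite F hF).image e.injective.injOn
  exists_point F hF := by
    obtain ⟨𝒱, hF𝒱, h𝒱⟩ := hρ.exists_point F hF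
    refine ⟨𝒱.map e, Filter.image_mem_map hF𝒱, fun G _ hG => ?_⟩
    obtain ⟨E, hE, hEG⟩ := h𝒱.exists_tendsto (f := e) (G := G) hG
    exact ⟨E, hE, (tailFilter_image hρ.mono e E).trans_le hEG⟩

end IsPRegular

end RhoCombinatorics

section SeparatingFamily

variable {Λ M : Type*}

theorem IsPRegular.exists_seq_finite_setOf_mem {ρ : Set ℕ → Set Λ} (hρ : IsPRegular ρ)
    {F : Set ℕ} (hF : F.Infinite) {ι : Type*} [Countable ι] {C : ι → Set Λ}
    (hC : ∀ i, RhoSmall ρ (C i)) :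
    ∃ a : ℕ → Λ, (∀ n, a n ∈ ρ (F \ Finset.range n)) ∧ ∀ i, {n | a n ∈ C i}.Finite := by
  obtain ⟨code, hcode⟩ := exists_injective_nat ι
  have hfin (n : ℕ) : {i | code i ≤ n}.Finite := (Set.finite_Iic n).preimage hcode.injOn
  choose a haF haC using fun n => hρ.exists_mem_forall_notMem
    (hF.sdiff (Finset.range n).finite_toSet) (hfin n) fun i _ => hC i
  exact ⟨a, haF, fun i => (Set.finite_Iio (code i)).subset fun n hn =>
    Set.mem_Iio.2 (not_le.1 fun h => haC n i h hn)⟩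

theorem IsPRegular.exists_rhoSmall_almostDisjoint [Countable Λ] {ρ : Set ℕ → Set Λ}
    (hρ : IsPRegular ρ) (tall : ∀ S : Set Λ, S.Infinite → ∃ A ⊆ S, A.Infinite ∧ RhoSmall ρ A)
    {𝒞 : Set (Set Λ)} (h𝒞 : 𝒞.Countable) (hsmall : ∀ C ∈ 𝒞, RhoSmall ρ C)
    {F : Set ℕ} (hF : F.Infinite) :
    ∃ A : Set Λ, RhoSmall ρ A ∧ (A.Infinite ∧ ∃ᶠ a in tailFilter ρ F, a ∈ A) ∧
      ∀ C ∈ 𝒞, (A ∩ C).Finite := by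
  have := h𝒞.to_subtype
  obtain ⟨a, haF, hfin⟩ := hρ.exists_seq_finite_setOf_mem hF
    (C := Sum.elim (fun C : 𝒞 => C.1) fun v => {v}) (Sum.rec (fun C => hsmall C.1 C.2) fun v =>
      hρ.rhoSmall_of_finite (Set.finite_singleton v))
  have hrange : (Set.range a).Infinite := fun h => Set.infinite_univ
    (α := ℕ) (Set.preimage_range a ▸ h.preimage' fun v _ => hfin (Sum.inr v))
  obtain ⟨A, hAa, hA, hAsmall⟩ := tall _ hrange
  refine ⟨A, hAsmall, ⟨hA, fun hev => ?_⟩, fun C hC => ?_⟩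
  · obtain ⟨K, hK⟩ := (mem_tailFilter hρ.mono).1 hev
    have hidx : {n | a n ∈ A}.Infinite := fun h => hA <| (h.image a).subset fun _ hx => by
      obtain ⟨n, rfl⟩ := hAa hx
      exact ⟨n, hx, rfl⟩
    obtain ⟨n, hnA, hn⟩ := hidx.exists_gt (K.sup id)
    exact hK (hρ.mono (Set.sdiff_subset_sdiff_right (Finset.coe_subset.2
      (K.subset_range_sup_succ.trans (Finset.range_mono hn)))) (haF n)) hnA
  · refine ((hfin (Sum.inl ⟨C, hC⟩)).image a).subset fun x hx => ?_
    obtain ⟨n, rfl⟩ := hAa hx.1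
    exact ⟨n, hx.2, rfl⟩

theorem exists_almostDisjoint_of_countable_step {I : Type*} [LinearOrder I] [WellFoundedLT I]
    (hI : ∀ i : I, (Set.Iio i).Countable) {𝒮 : Set (Set M)} {Q : I → Set M → Prop} {B : I → Set M}
    (hB : ∀ i, B i ∈ 𝒮)
    (step : ∀ i, ∀ 𝒞 : Set (Set M), 𝒞.Countable → 𝒞 ⊆ 𝒮 →
      ∃ A ∈ 𝒮, Q i A ∧ ∀ C ∈ 𝒞, (A ∩ C).Finite) :
    ∃ A : I → Set M, (∀ i, A i ∈ 𝒮 ∧ Q i (A i)) ∧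
      ∀ i, ∀ j < i, (A i ∩ A j).Finite ∧ (A i ∩ B j).Finite := by
  have next (i : I) (prev : ∀ j < i, 𝒮) : ∃ A : 𝒮, Q i A ∧
      ∀ j (hj : j < i), (A ∩ prev j hj : Set M).Finite ∧ (A ∩ B j : Set M).Finite := by
    have := (hI i).to_subtype
    obtain ⟨A, hA𝒮, hQ, hA⟩ := step i
      (Set.range (fun j : Set.Iio i => (prev j j.2 : Set M)) ∪ B '' Set.Iio i)
      ((Set.countable_range _).union ((hI i).image B)) (Set.union_subset
        (Set.range_subset_iff.2 fun j => (prev j j.2).2) (Set.image_subset_iff.2 fun j _ => hB j))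
    exact ⟨⟨A, hA𝒮⟩, hQ, fun j hj => ⟨hA _ (.inl ⟨⟨j, hj⟩, rfl⟩), hA _ (.inr ⟨j, hj, rfl⟩)⟩⟩
  choose next hQ hnext using next
  have wf : WellFounded ((· < ·) : I → I → Prop) := wellFounded_lt
  let A : I → 𝒮 := wf.fix next
  have hA (i : I) : A i = next i fun j _ => A j := wf.fix_eq next i
  have hAQ (i : I) : Q i (A i) := by
    rw [hA]
    exact hQ _ _
  have hAB (i j : I) (hj : j < i) : (A i ∩ A j : Set M).Finite ∧ (A i ∩ B j : Set M).Finite := by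
    rw [hA i]
    exact hnext i (fun j _ => A j) j hj
  exact ⟨fun i => A i, fun i => ⟨(A i).2, hAQ i⟩, hAB⟩

theorem exists_wellOrder_countable_Iio (CH : Cardinal.continuum.{0} = Cardinal.aleph.{0} 1) :
    ∃ (I : Type) (_ : LinearOrder I) (_ : WellFoundedLT I),
      #I = 𝔠 ∧ ∀ i : I, (Set.Iio i).Countable := by
  have hI : #(Cardinal.continuum.{0}).ord.ToType = 𝔠 := by
    rw [Cardinal.mk_toType, Cardinal.card_ord]
  refine ⟨(Cardinal.continuum.{0}).ord.ToType, inferInstance, inferInstance, hI, fun i => ?_⟩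
  rw [← Cardinal.le_aleph0_iff_set_countable, ← Order.lt_succ_iff, Cardinal.succ_aleph0, ← CH]
  exact (Cardinal.mk_Iio_lt i (by rw [hI, Ordinal.type_toType])).trans_eq hI

theorem exists_surjective_of_mk_le.{u} {I J : Type u} [Nonempty J] (h : #J ≤ #I) :
    ∃ e : I → J, e.Surjective := by
  obtain ⟨e⟩ := h
  exact ⟨_, Function.invFun_surjective e.injective⟩

theorem mk_arrow_nat_le_continuum (Λ : Type) [Countable Λ] : #(Λ → ℕ) ≤ 𝔠 := by
  rw [← Cardinal.power_def, Cardinal.mk_nat, ← Cardinal.aleph0_power_aleph0]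
  exact Cardinal.power_le_power_left Cardinal.aleph0_ne_zero Cardinal.mk_le_aleph0

theorem mk_infinite_sets_le_continuum : #{F : Set ℕ // F.Infinite} ≤ 𝔠 :=
  (Cardinal.mk_subtype_le _).trans_eq (by
    rw [Cardinal.mk_set, Cardinal.mk_nat, Cardinal.two_power_aleph0])

theorem exists_infinite_subset_rhoSmall [Countable Λ] {ρ₁ : Set ℕ → Set Λ} {ρ₂ : Set ℕ → Set M}
    (h₁ : IsPRegular ρ₁) (H : ∀ g : Λ → M, ∃ F : Set ℕ, F.Infinite ∧ RhoSmall ρ₂ (g '' ρ₁ F))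
    {S : Set M} (hS : S.Infinite) : ∃ A ⊆ S, A.Infinite ∧ RhoSmall ρ₂ A := by
  obtain ⟨code, hcode⟩ := exists_injective_nat Λ
  have : Infinite S := hS.to_subtype
  let j := Infinite.natEmbedding S
  obtain ⟨F, hF, hsmall⟩ := H fun a => j (code a)
  exact ⟨_, Set.image_subset_iff.2 fun a _ => (j (code a)).2, (h₁.infinite F hF).image
    (Subtype.val_injective.comp (j.injective.comp hcode)).injOn, hsmall⟩

theorem exists_almostDisjointFamily_separating
    (CH : Cardinal.continuum.{0} = Cardinal.aleph.{0} 1) {Λ : Type} [Countable Λ]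
    {ρ₁ : Set ℕ → Set Λ} {ρ₂ : Set ℕ → Set ℕ} (h₁ : IsPRegular ρ₁) (h₂ : IsPRegular ρ₂)
    (H : ∀ g : Λ → ℕ, ∃ F : Set ℕ, F.Infinite ∧ RhoSmall ρ₂ (g '' ρ₁ F)) :
    ∃ 𝒜 : Set (Set ℕ), IsAlmostDisjointFamily 𝒜 ∧ #𝒜 = 𝔠 ∧ (∀ A ∈ 𝒜, RhoSmall ρ₂ A) ∧
      (∀ F : Set ℕ, F.Infinite → ∃ A ∈ 𝒜, ∃ᶠ n in tailFilter ρ₂ F, n ∈ A) ∧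
      ∀ g : Λ → ℕ, ∃ F : Set ℕ, F.Infinite ∧ {A ∈ 𝒜 | (A ∩ g '' ρ₁ F).Infinite}.Countable := by
  obtain ⟨I, _, _, hI, hIio⟩ := exists_wellOrder_countable_Iio CH
  have : Nonempty {F : Set ℕ // F.Infinite} := ⟨⟨Set.univ, Set.infinite_univ⟩⟩
  obtain ⟨D, hD⟩ := exists_surjective_of_mk_le
    (mk_infinite_sets_le_continuum.trans_eq hI.symm)
  obtain ⟨g, hg⟩ := exists_surjective_of_mk_le
    ((mk_arrow_nat_le_continuum Λ).trans_eq hI.symm)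
  choose G hG hGsmall using H
  obtain ⟨A, hA, hAB⟩ := exists_almostDisjoint_of_countable_step hIio
    (𝒮 := {C | RhoSmall ρ₂ C})
    (Q := fun i A => A.Infinite ∧ ∃ᶠ n in tailFilter ρ₂ (D i).1, n ∈ A)
    (B := fun i => g i '' ρ₁ (G (g i))) (fun i => hGsmall (g i)) fun i 𝒞 h𝒞 hsmall =>
      h₂.exists_rhoSmall_almostDisjoint (fun S => exists_infinite_subset_rhoSmall h₁
        fun g => ⟨G g, hG g, hGsmall g⟩) h𝒞 hsmall (D i).2
  have hdisj {i j : I} (hij : i ≠ j) : (A i ∩ A j).Finite := by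
    rcases lt_or_gt_of_ne hij with h | h
    · exact Set.inter_comm (A i) (A j) ▸ (hAB j i h).1
    · exact (hAB i j h).1
  have hinj : A.Injective := fun i j hij => by_contra fun hne =>
    (hA i).2.1 (by simpa only [hij, Set.inter_self] using hdisj hne)
  refine ⟨Set.range A, ⟨Set.forall_mem_range.2 fun i => (hA i).2.1, ?_⟩,
    (Cardinal.mk_range_eq _ hinj).trans hI, Set.forall_mem_range.2 fun i => (hA i).1,
    fun F hF => ?_, fun f => ?_⟩
  · rintro _ ⟨i, rfl⟩ _ ⟨j, rfl⟩ hij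
    exact hdisj (ne_of_apply_ne A hij)
  · obtain ⟨i, hi⟩ := hD ⟨F, hF⟩
    exact ⟨A i, ⟨i, rfl⟩, by simpa only [hi] using (hA i).2.2⟩
  · obtain ⟨j, rfl⟩ := hg f
    refine ⟨G (g j), hG _, (((hIio j).insert j).image A).mono ?_⟩
    rintro _ ⟨⟨i, rfl⟩, hi⟩
    rw [Set.Iio_insert]
    exact ⟨i, not_lt.1 fun hji => hi (hAB i j hji).2, rfl⟩

end SeparatingFamily

section PsiTopology

variable {𝒜 : Set (Set ℕ)}

theorem separableSpace_onePoint (X : Type*) [TopologicalSpace X]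
    [TopologicalSpace.SeparableSpace X] : TopologicalSpace.SeparableSpace (OnePoint X) := by
  rw [← TopologicalSpace.isSeparable_univ_iff, ← OnePoint.range_coe_union_infty]
  exact (TopologicalSpace.isSeparable_range OnePoint.continuous_coe).union
    (Set.finite_singleton _).isSeparable

namespace Psi

theorem isOpen_iff {U : Set (Psi 𝒜)} : IsOpen U ↔ ∀ A : 𝒜, ofMem A ∈ U →
    ∀ᶠ n in Filter.cofinite, n ∈ (A : Set ℕ) → ofNat n ∈ U := by
  refine forall₂_congr fun A _ => ⟨fun ⟨F, hF⟩ => ?_, fun h => ?_⟩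
  · exact F.finite_toSet.subset fun n hn => by_contra fun hnF => hn fun hnA => hF n ⟨hnA, hnF⟩
  · refine ⟨Set.Finite.toFinset h, fun n hn => by_contra fun hnU => hn.2 ?_⟩
    exact Finset.mem_coe.2 ((Set.Finite.mem_toFinset h).2 fun hU => hnU (hU hn.1))

theorem ofNat_injective : Function.Injective (ofNat : ℕ → Psi 𝒜) := Sum.inl_injective

theorem ofMem_ne_ofNat (A : 𝒜) (n : ℕ) : (ofMem A : Psi 𝒜) ≠ ofNat n := Sum.inr_ne_inl

/-- The set of natural numbers represented by a point of `Ψ(𝒜)`: `A` itself for `A ∈ 𝒜`, and `{n}`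
for `n ∈ ℕ`. -/
def trace (t : Psi 𝒜) : Set ℕ := Sum.elim (fun n => {n}) (fun A : 𝒜 => (A : Set ℕ)) t

theorem trace_ofNat (n : ℕ) : trace (ofNat n : Psi 𝒜) = {n} := rfl

/-- The largest basic neighbourhood of a point of `Ψ(𝒜)`: `{A} ∪ A` for `A ∈ 𝒜`, and `{n}` for
`n ∈ ℕ`. -/
def cell (t : Psi 𝒜) : Set (Psi 𝒜) := insert t (ofNat '' trace t)

theorem mem_cell_self (t : Psi 𝒜) : t ∈ cell t := Set.mem_insert _ _

theorem ofNat_mem_cell {t : Psi 𝒜} {n : ℕ} : ofNat n ∈ cell t ↔ n ∈ trace t := by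
  refine ⟨?_, fun h => Or.inr ⟨n, h, rfl⟩⟩
  rintro (rfl | ⟨m, hm, hmn⟩)
  · exact Set.mem_singleton n
  · exact ofNat_injective hmn ▸ hm

theorem ofMem_mem_cell {t : Psi 𝒜} {A : 𝒜} : ofMem A ∈ cell t ↔ ofMem A = t :=
  or_iff_left fun ⟨n, _, h⟩ => ofMem_ne_ofNat A n h.symm

theorem cell_ofNat (n : ℕ) : cell (ofNat n : Psi 𝒜) = {ofNat n} := by
  rw [cell, trace_ofNat, Set.image_singleton, Set.insert_eq_of_mem (Set.mem_singleton _)]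

theorem mem_nhds_iff {t : Psi 𝒜} {U : Set (Psi 𝒜)} :
    U ∈ 𝓝 t ↔ t ∈ U ∧ ∀ᶠ n in Filter.cofinite, n ∈ trace t → ofNat n ∈ U := by
  refine ⟨fun hU => ⟨mem_of_mem_nhds hU, ?_⟩, fun ⟨htU, hU⟩ => ?_⟩
  · obtain ⟨V, hVU, hV, htV⟩ := _root_.mem_nhds_iff.1 hU
    rcases t with n | A
    · exact Filter.Eventually.of_forall fun m hm => (Set.mem_singleton_iff.1 hm) ▸ hVU htV
    · exact (isOpen_iff.1 hV A htV).mono fun n hn hnA => hVU (hn hnA)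
  · refine Filter.mem_of_superset (IsOpen.mem_nhds (s := insert t (ofNat '' (ofNat ⁻¹' U)))
      (isOpen_iff.2 fun A hA => ?_) (Set.mem_insert _ _))
      (Set.insert_subset htU (Set.image_preimage_subset _ _))
    obtain rfl : ofMem A = t := hA.resolve_right fun ⟨n, _, h⟩ => ofMem_ne_ofNat A n h.symm
    exact hU.mono fun n hn hnA => Or.inr ⟨n, hn hnA, rfl⟩

theorem nhds_eq (t : Psi 𝒜) :
    𝓝 t = pure t ⊔ (Filter.cofinite ⊓ Filter.principal (trace t)).map ofNat :=
  Filter.ext fun _ => by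
    simp only [mem_nhds_iff, Filter.mem_sup, Filter.mem_pure, Filter.mem_map,
      Filter.mem_inf_principal, Filter.Eventually, Set.mem_preimage]

theorem firstCountableTopology : FirstCountableTopology (Psi 𝒜) where
  nhds_generated_countable t := by
    rw [nhds_eq, Nat.cofinite_eq_atTop]
    infer_instance

theorem isOpen_cell (t : Psi 𝒜) : IsOpen (cell t) :=
  isOpen_iff.2 fun _ hA => Filter.Eventually.of_forall fun _ hn =>
    ofNat_mem_cell.2 (ofMem_mem_cell.1 hA ▸ hn)

theorem cell_mem_nhds (t : Psi 𝒜) : cell t ∈ 𝓝 t := (isOpen_cell t).mem_nhds (mem_cell_self t)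

theorem isCompact_cell (t : Psi 𝒜) : IsCompact (cell t) := by
  rw [cell, Set.image_eq_range]
  refine Filter.Tendsto.isCompact_insert_range_of_cofinite fun U hU => ?_
  exact (Subtype.val_injective.tendsto_cofinite.eventually (mem_nhds_iff.1 hU).2).mono
    fun n hn => hn n.2

theorem finite_inter_trace (h𝒜 : IsAlmostDisjointFamily 𝒜) {A : 𝒜} {t : Psi 𝒜}
    (ht : ofMem A ≠ t) : ((A : Set ℕ) ∩ trace t).Finite := by
  rcases t with n | B
  · exact (Set.finite_singleton n).subset Set.inter_subset_right
  · exact h𝒜.2 A A.2 B B.2 fun h => ht (congrArg ofMem (Subtype.ext h))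

theorem isClosed_cell (h𝒜 : IsAlmostDisjointFamily 𝒜) (t : Psi 𝒜) : IsClosed (cell t) := by
  rw [← isOpen_compl_iff, isOpen_iff]
  intro A hA
  exact (finite_inter_trace h𝒜 fun h => hA (ofMem_mem_cell.2 h)).subset fun n hn =>
    by_contra fun hnt => hn fun hnA hnc => hnt ⟨hnA, ofNat_mem_cell.1 hnc⟩

theorem totallySeparatedSpace (h𝒜 : IsAlmostDisjointFamily 𝒜) : TotallySeparatedSpace (Psi 𝒜) := by
  refine totallySeparatedSpace_iff_exists_isClopen.2 fun s t hst => ?_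
  have isClopen_cell (u : Psi 𝒜) : IsClopen (cell u) := ⟨isClosed_cell h𝒜 u, isOpen_cell u⟩
  by_cases ht : t ∈ cell s
  · obtain ⟨n, -, rfl⟩ := ht.resolve_left hst.symm
    refine ⟨_, (isClopen_cell (ofNat n)).compl, ?_, Set.notMem_compl_iff.2 (mem_cell_self _)⟩
    rwa [cell_ofNat]
  · exact ⟨_, isClopen_cell s, mem_cell_self s, ht⟩

theorem weaklyLocallyCompactSpace : WeaklyLocallyCompactSpace (Psi 𝒜) :=
  ⟨fun t => ⟨cell t, isCompact_cell t, cell_mem_nhds t⟩⟩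

theorem denseRange_ofNat (h𝒜 : IsAlmostDisjointFamily 𝒜) :
    DenseRange (ofNat : ℕ → Psi 𝒜) := by
  refine fun t => mem_closure_iff_nhds.2 fun U hU => ?_
  rcases t with n | A
  · exact ⟨_, mem_of_mem_nhds hU, n, rfl⟩
  · obtain ⟨n, hnU, hnA⟩ := ((h𝒜.1 A A.2).frequently_cofinite.and_eventually
      (mem_nhds_iff.1 hU).2).exists
    exact ⟨_, hnA hnU, n, rfl⟩

end Psi

theorem IsAlmostDisjointFamily.isGoodFamily (h𝒜 : IsAlmostDisjointFamily 𝒜) (hc : #𝒜 = 𝔠) :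
    IsGoodFamily 𝒜 where
  almostDisjoint := h𝒜
  hausdorff := by
    have := Psi.totallySeparatedSpace h𝒜
    have := Psi.weaklyLocallyCompactSpace (𝒜 := 𝒜)
    infer_instance
  compact := inferInstance
  separable := by
    have := (Psi.denseRange_ofNat h𝒜).separableSpace'
    exact separableSpace_onePoint _
  card := by
    have hPhi : #(Phi 𝒜) = #(Option (ℕ ⊕ 𝒜)) := rfl
    rw [hPhi, Cardinal.mk_option, Cardinal.mk_sum, hc, Cardinal.mk_nat, Cardinal.lift_aleph0,
      Cardinal.lift_continuum, Cardinal.aleph0_add_continuum,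
      Cardinal.add_one_eq Cardinal.aleph0_le_continuum]

end PsiTopology

section PhiConvergence

namespace Phi

variable {Λ : Type*} {𝒜 : Set (Set ℕ)} {f : Λ → Phi 𝒜}

theorem tendsto_infty_iff (h𝒜 : IsAlmostDisjointFamily 𝒜) {l : Filter Λ} :
    Filter.Tendsto f l (𝓝 OnePoint.infty) ↔ ∀ t : Psi 𝒜, ∀ᶠ a in l, f a ∉ (↑) '' Psi.cell t := by
  refine ⟨fun h t => h ((OnePoint.isOpen_compl_image_coe.2 ⟨Psi.isClosed_cell h𝒜 t,
    Psi.isCompact_cell t⟩).mem_nhds OnePoint.infty_notMem_image_coe), fun h => ?_⟩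
  refine OnePoint.hasBasis_nhds_infty.tendsto_right_iff.2 fun s ⟨_, hs⟩ => ?_
  obtain ⟨T, -, hT⟩ := hs.elim_nhds_subcover Psi.cell fun t _ => Psi.cell_mem_nhds t
  filter_upwards [(Filter.eventually_all_finset T).2 fun t _ => h t] with a ha
  rw [← OnePoint.compl_image_coe]
  rintro ⟨y, hy, hya⟩
  obtain ⟨t, ht, hyt⟩ := Set.mem_iUnion₂.1 (hT hy)
  exact ha t ht ⟨y, hyt, hya⟩

theorem eventually_notMem_cell {l : Filter Λ} {S : Set Λ} (hS : S ∈ l) {t : Psi 𝒜}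
    (hfin : (Psi.trace t ∩ {n | ((Psi.ofNat n : Psi 𝒜) : Phi 𝒜) ∈ f '' S}).Finite)
    (ht : ∀ᶠ a in l, f a ≠ t) (hnat : ∀ n, ∀ᶠ a in l, f a ≠ (Psi.ofNat n : Psi 𝒜)) :
    ∀ᶠ a in l, f a ∉ (↑) '' Psi.cell t := by
  filter_upwards [hS, ht, hfin.eventually_all.2 fun n _ => hnat n] with a haS hat han
  rintro ⟨_, rfl | ⟨n, hn, rfl⟩, hya⟩
  · exact hat hya.symm
  · exact han n ⟨hn, a, haS, hya.symm⟩ hya.symm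

theorem countable_setOf_infinite_trace_inter {N : Set ℕ}
    (hN : {A ∈ 𝒜 | (A ∩ N).Infinite}.Countable) :
    {t : Psi 𝒜 | (Psi.trace t ∩ N).Infinite}.Countable := by
  refine ((hN.preimage Subtype.val_injective).image (Psi.ofMem (𝒜 := 𝒜))).mono fun t ht => ?_
  rcases t with n | A
  · exact absurd ((Set.finite_singleton n).subset Set.inter_subset_left) ht
  · exact ⟨A, ⟨A.2, ht⟩, rfl⟩

theorem ofNat_injective : Function.Injective fun n => ((Psi.ofNat n : Psi 𝒜) : Phi 𝒜) :=
  OnePoint.coe_injective.comp Psi.ofNat_injective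

theorem exists_tendsto_infty [Countable Λ] {ρ : Set ℕ → Set Λ} (h𝒜 : IsAlmostDisjointFamily 𝒜)
    {𝒱 : Ultrafilter Λ} (h𝒱 : IsRhoPoint ρ 𝒱) (hf : Filter.Tendsto f 𝒱 (𝓝 OnePoint.infty))
    {S : Set Λ} (hS : S ∈ 𝒱)
    (hcount : {A ∈ 𝒜 |
      (A ∩ {n | ((Psi.ofNat n : Psi 𝒜) : Phi 𝒜) ∈ f '' S}).Infinite}.Countable) :
    ∃ F : Set ℕ, F.Infinite ∧ Filter.Tendsto f (tailFilter ρ F) (𝓝 OnePoint.infty) := by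
  -- A point outside `bad` need not be avoided by hand: its cell contains only finitely many
  -- isolated points in the image of `S`, and each of these is bad.
  let bad : Set (Psi 𝒜) := Set.range Psi.ofNat ∪ (↑) ⁻¹' Set.range f ∪
    {t | (Psi.trace t ∩ {n | ((Psi.ofNat n : Psi 𝒜) : Phi 𝒜) ∈ f '' S}).Infinite}
  have hbad : bad.Countable := ((Set.countable_range _).union
    ((Set.countable_range f).preimage OnePoint.coe_injective)).union
      (countable_setOf_infinite_trace_inter hcount)
  have := hbad.to_subtype
  let G : Filter Λ :=
    Filter.principal S ⊓ ⨅ t : bad, Filter.principal {a | f a ∉ (↑) '' Psi.cell t.1}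
  have hG : ↑𝒱 ≤ G := le_inf (Filter.le_principal_iff.2 hS) <| le_iInf fun t =>
    Filter.le_principal_iff.2 ((tendsto_infty_iff h𝒜).1 hf t)
  obtain ⟨F, hF, hFG⟩ := h𝒱 G inferInstance hG
  have havoid : ∀ t ∈ bad, ∀ᶠ a in tailFilter ρ F, f a ∉ (↑) '' Psi.cell t := fun t ht =>
    hFG (Filter.mem_inf_of_right (Filter.mem_iInf_of_mem ⟨t, ht⟩ (Filter.mem_principal_self _)))
  refine ⟨F, hF, (tendsto_infty_iff h𝒜).2 fun t => ?_⟩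
  by_cases ht : t ∈ bad
  · exact havoid t ht
  · refine eventually_notMem_cell (hFG (Filter.mem_inf_of_left (Filter.mem_principal_self S)))
      (Set.not_infinite.1 fun h => ht (Or.inr h))
      (Filter.Eventually.of_forall fun a ha => ht (Or.inl (Or.inr ⟨a, ha⟩))) fun n => ?_
    exact (havoid _ (Or.inl (Or.inl ⟨n, rfl⟩))).mono fun a ha han =>
      ha ⟨_, Psi.mem_cell_self _, han.symm⟩

theorem finBW_of_countable_infinite_inter [Countable Λ] {ρ : Set ℕ → Set Λ} (hρ : IsPRegular ρ)
    (h𝒜 : IsAlmostDisjointFamily 𝒜)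
    (H : ∀ g : Λ → ℕ, ∃ F : Set ℕ, F.Infinite ∧ {A ∈ 𝒜 | (A ∩ g '' ρ F).Infinite}.Countable) :
    FinBW ρ (Phi 𝒜) := by
  intro f
  let natPart : Phi 𝒜 → ℕ := Function.invFun fun n => ((Psi.ofNat n : Psi 𝒜) : Phi 𝒜)
  have hnatPart (n : ℕ) : natPart (Psi.ofNat n : Psi 𝒜) = n :=
    Function.leftInverse_invFun ofNat_injective n
  obtain ⟨F₀, hF₀, hcount⟩ := H (natPart ∘ f)
  obtain ⟨𝒱, hF₀𝒱, h𝒱⟩ := hρ.exists_point F₀ hF₀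
  obtain ⟨x, hx⟩ : ∃ x, Filter.Tendsto f 𝒱 (𝓝 x) := ⟨_, (𝒱.map f).le_nhds_lim⟩
  suffices ∃ F : Set ℕ, F.Infinite ∧ Filter.Tendsto f (tailFilter ρ F) (𝓝 x) by
    obtain ⟨F, hF, hFx⟩ := this
    exact ⟨F, hF, x, (rhoConverges_iff_tendsto hρ.mono).2 hFx⟩
  induction x using OnePoint.rec with
  | infty =>
    have hsub : {n | ((Psi.ofNat n : Psi 𝒜) : Phi 𝒜) ∈ f '' ρ F₀} ⊆ natPart ∘ f '' ρ F₀ :=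
      fun n ⟨a, ha, han⟩ => ⟨a, ha, by rw [Function.comp_apply, han, hnatPart]⟩
    refine exists_tendsto_infty h𝒜 h𝒱 hx hF₀𝒱 (hcount.mono fun A hA => ?_)
    exact ⟨hA.1, hA.2.mono (Set.inter_subset_inter_right A hsub)⟩
  | coe t =>
    have := Psi.firstCountableTopology (𝒜 := 𝒜)
    have : (𝓝 (t : Phi 𝒜)).IsCountablyGenerated := by
      rw [OnePoint.nhds_coe_eq]
      infer_instance
    exact h𝒱.exists_tendsto hx

theorem not_finBW_of_rhoSmall {ρ : Set ℕ → Set ℕ} (hρ : IsPRegular ρ)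
    (h𝒜 : IsAlmostDisjointFamily 𝒜) (hsmall : ∀ A ∈ 𝒜, RhoSmall ρ A)
    (hmeet : ∀ F : Set ℕ, F.Infinite → ∃ A ∈ 𝒜, ∃ᶠ n in tailFilter ρ F, n ∈ A) :
    ¬ FinBW ρ (Phi 𝒜) := by
  intro h
  obtain ⟨F, hF, x, hx⟩ := h fun n => ((Psi.ofNat n : Psi 𝒜) : Phi 𝒜)
  rw [rhoConverges_iff_tendsto hρ.mono] at hx
  induction x using OnePoint.rec with
  | infty =>
    obtain ⟨A, hA, hAF⟩ := hmeet F hF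
    obtain ⟨n, hnA, hn⟩ :=
      (hAF.and_eventually ((tendsto_infty_iff h𝒜).1 hx (Psi.ofMem ⟨A, hA⟩))).exists
    exact hn ⟨_, Psi.ofNat_mem_cell.2 hnA, rfl⟩
  | coe t =>
    have htrace : RhoSmall ρ (Psi.trace t) := by
      rcases t with n | A
      exacts [hρ.rhoSmall_of_finite (Set.finite_singleton n), hsmall A A.2]
    have hcell : ∀ᶠ n in tailFilter ρ F, n ∈ Psi.trace t := by
      rw [OnePoint.nhds_coe_eq] at hx
      filter_upwards [hx (Filter.image_mem_map (Psi.cell_mem_nhds t))] with n hn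
      exact Psi.ofNat_mem_cell.1 ((OnePoint.coe_injective.mem_set_image).1 hn)
    obtain ⟨K, hK⟩ := (mem_tailFilter hρ.mono).1 hcell
    exact htrace _ (hF.sdiff K.finite_toSet) hK

end Phi

theorem exists_isGoodFamily_finBW_not_finBW
    (CH : Cardinal.continuum.{0} = Cardinal.aleph.{0} 1) {Λ M : Type} [Countable Λ] [Countable M]
    {ρ₁ : Set ℕ → Set Λ} {ρ₂ : Set ℕ → Set M} (h₁ : IsPRegular ρ₁) (h₂ : IsPRegular ρ₂)
    (H : ∀ g : Λ → M, ∃ F : Set ℕ, F.Infinite ∧ RhoSmall ρ₂ (g '' ρ₁ F)) :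
    ∃ 𝒜 : Set (Set ℕ), IsGoodFamily 𝒜 ∧ FinBW ρ₁ (Phi 𝒜) ∧ ¬ FinBW ρ₂ (Phi 𝒜) := by
  have : Infinite M := Set.infinite_univ_iff.1
    ((h₂.infinite _ Set.infinite_univ).mono (Set.subset_univ _))
  obtain ⟨e⟩ : Nonempty (M ≃ ℕ) := nonempty_equiv_of_countable
  have he := h₂.image_equiv e
  obtain ⟨𝒜, h𝒜, hcard, hsmall, hmeet, hcount⟩ :=
    exists_almostDisjointFamily_separating CH h₁ he fun g => by
      obtain ⟨F, hF, hFsmall⟩ := H (e.symm ∘ g)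
      refine ⟨F, hF, ?_⟩
      simpa only [← Set.image_comp, ← Function.comp_assoc, e.self_comp_symm, Function.id_comp]
        using hFsmall.image_equiv e
  exact ⟨𝒜, h𝒜.isGoodFamily hcard, Phi.finBW_of_countable_infinite_inter h₁ h𝒜 hcount, fun h =>
    Phi.not_finBW_of_rhoSmall he h𝒜 hsmall hmeet
      (h.of_subset_image e fun F hF => ⟨F, hF, fun K => ⟨K, subset_rfl⟩⟩)⟩

end PhiConvergence

section GenericSequences

variable {α β : Type*}

/-- The filter of properties of sequences that can be enforced by requiring each term to belong to
a `U`-large set chosen in terms of the earlier terms. -/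
def seqAlong (U : Filter α) : Filter (ℕ → α) where
  sets := {X | ∃ S : ∀ n, (Fin n → α) → Set α, (∀ n h, S n h ∈ U) ∧
    ∀ x : ℕ → α, (∀ n, x n ∈ S n fun i => x i) → x ∈ X}
  univ_sets := ⟨fun _ _ => Set.univ, fun _ _ => Filter.univ_mem, fun _ _ => trivial⟩
  sets_of_superset := fun ⟨S, hS, hx⟩ h => ⟨S, hS, fun x hxS => h (hx x hxS)⟩
  inter_sets := fun ⟨S, hS, hx⟩ ⟨T, hT, hy⟩ =>
    ⟨fun n h => S n h ∩ T n h, fun n h => Filter.inter_mem (hS n h) (hT n h),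
      fun x hxST => ⟨hx x fun n => (hxST n).1, hy x fun n => (hxST n).2⟩⟩

theorem eventually_seqAlong {U : Filter α} {S : ∀ n, (Fin n → α) → α → Prop}
    (hS : ∀ n h, ∀ᶠ a in U, S n h a) :
    ∀ᶠ x in seqAlong U, ∀ n, S n (fun i => x i) (x n) :=
  ⟨fun n h => {a | S n h a}, hS, fun _ hx => hx⟩

instance seqAlong_neBot (U : Filter α) [U.NeBot] : (seqAlong U).NeBot := by
  rw [← Filter.forall_mem_nonempty_iff_neBot]
  rintro X ⟨S, hS, hX⟩
  choose a ha using fun n h => U.nonempty_of_mem (hS n h)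
  let x : ℕ → α := wellFounded_lt.fix fun n h => a n fun i => h i i.2
  refine ⟨x, hX x fun n => ?_⟩
  rw [show x n = a n fun i => x i from wellFounded_lt.fix_eq _ n]
  exact ha n _

theorem eventually_imp_self (U : Filter α) (p : α → Prop) : ∀ᶠ a in U, (∀ᶠ b in U, p b) → p a := by
  by_cases h : ∀ᶠ b in U, p b
  · exact h.mono fun _ ha _ => ha
  · exact Filter.Eventually.of_forall fun _ h' => absurd h' h

theorem eventually_forall_lt {U : Filter α} {p : ℕ → α → α → Prop}
    (hp : ∀ n, ∀ᶠ a in U, ∀ᶠ b in U, p n a b) :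
    ∀ᶠ x in seqAlong U, ∀ i j, i < j → p i (x i) (x j) := by
  have hrule := eventually_seqAlong (U := U)
    (S := fun n h a => (∀ᶠ b in U, p n a b) ∧ ∀ i : Fin n, (∀ᶠ b in U, p i (h i) b) → p i (h i) a)
    fun n h => (hp n).and (Filter.eventually_all.2 fun i => eventually_imp_self U _)
  filter_upwards [hrule] with x hx i j hij using (hx j).2 ⟨i, hij⟩ (hx i).1

theorem eventually_forall_lt_lt {U : Filter α} {p : α → α → α → Prop}
    (hp : ∀ᶠ a in U, ∀ᶠ b in U, ∀ᶠ c in U, p a b c) :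
    ∀ᶠ x in seqAlong U, ∀ i j l, i < j → j < l → p (x i) (x j) (x l) := by
  have hrule := eventually_seqAlong (U := U)
    (S := fun n h c => ∀ i j : Fin n, (∀ᶠ c' in U, p (h i) (h j) c') → p (h i) (h j) c)
    fun n h => Filter.eventually_all.2 fun i => Filter.eventually_all.2 fun j =>
      eventually_imp_self U _
  filter_upwards [hrule, eventually_forall_lt fun _ => hp] with x hx hpair i j l hij hjl
  exact hx l ⟨i, hij.trans hjl⟩ ⟨j, hjl⟩ (hpair i j hij)

theorem eventually_injective_comp {U : Filter α} {L : α → β} (hL : ∀ v, ∀ᶠ a in U, L a ≠ v) :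
    ∀ᶠ x in seqAlong U, Function.Injective (L ∘ x) := by
  filter_upwards [eventually_forall_lt (p := fun _ a b => L b ≠ L a)
    fun _ => Filter.Eventually.of_forall fun a => hL (L a)] with x hx
  exact Function.Injective.of_lt_imp_ne fun i j hij h => hx i j hij h.symm

theorem eventually_eq_of_apply_eq {U : Filter α} {b : α → α → β}
    (hb : ∀ᶠ k in U, ∀ v, ∀ᶠ m in U, b k m ≠ v) :
    ∀ᶠ x in seqAlong U, ∀ i j i' j', i < j → i' < j' →
      b (x i) (x j) = b (x i') (x j') → j = j' := by
  have hrule := eventually_seqAlong (U := U)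
    (S := fun n h c => (∀ v, ∀ᶠ m in U, b c m ≠ v) ∧ ∀ i i' j' : Fin n,
      (∀ᶠ m in U, b (h i) m ≠ b (h i') (h j')) → b (h i) c ≠ b (h i') (h j'))
    fun n h => hb.and (Filter.eventually_all.2 fun i => Filter.eventually_all.2 fun i' =>
      Filter.eventually_all.2 fun j' => eventually_imp_self U _)
  filter_upwards [hrule] with x hx
  have hne : ∀ i j i' j', i < j → i' < j' → j' < j → b (x i) (x j) ≠ b (x i') (x j') :=
    fun i j i' j' hij hij' hj =>
      (hx j).2 ⟨i, hij⟩ ⟨i', hij'.trans hj⟩ ⟨j', hj⟩ ((hx i).1 _)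
  intro i j i' j' hij hij' heq
  by_contra hj
  rcases lt_or_gt_of_ne hj with hj | hj
  · exact hne i' j' i j hij' hij hj heq.symm
  · exact hne i j i' j' hij hij' hj heq

theorem eventually_const_or_forall_eventually_ne (U : Ultrafilter α) (L : α → β) :
    (∃ v, ∀ᶠ a in U, L a = v) ∨ ∀ v, ∀ᶠ a in U, L a ≠ v := by
  simpa only [not_exists, Ultrafilter.eventually_not] using
    em (∃ v, ∀ᶠ a in U, L a = v)

theorem eventually_left_or_forall_eventually_ne (U : Ultrafilter α) (b : α → α → β) :
    (∃ L : α → β, ∀ᶠ k in U, ∀ᶠ m in U, b k m = L k) ∨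
      ∀ᶠ k in U, ∀ v, ∀ᶠ m in U, b k m ≠ v := by
  by_cases h : ∀ᶠ k in U, ∃ v, ∀ᶠ m in U, b k m = v
  · obtain ⟨k₀, v₀, -⟩ := h.exists
    have : Nonempty β := ⟨v₀⟩
    choose! L hL using fun (k : α) (h : ∃ v, ∀ᶠ m in U, b k m = v) => h
    exact Or.inl ⟨L, h.mono hL⟩
  · refine Or.inr ((Ultrafilter.eventually_not.2 h).mono fun k hk => ?_)
    exact (eventually_const_or_forall_eventually_ne U (b k)).resolve_left hk

theorem eventually_strictMono {U : Filter ℕ} (hU : U ≤ Filter.cofinite) :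
    ∀ᶠ x in seqAlong U, StrictMono x := by
  rw [Nat.cofinite_eq_atTop] at hU
  filter_upwards [eventually_forall_lt (p := fun _ => (· < ·))
    fun _ => Filter.Eventually.of_forall fun a => hU (Filter.eventually_gt_atTop a)] with x hx i j
  exact hx i j

theorem exists_ultrafilter_le_cofinite {F : Set α} (hF : F.Infinite) :
    ∃ U : Ultrafilter α, (U : Filter α) ≤ Filter.cofinite ∧ F ∈ U := by
  have := Filter.cofinite_inf_principal_neBot_iff.2 hF
  have hle := Ultrafilter.of_le (Filter.cofinite ⊓ Filter.principal F)
  exact ⟨_, hle.trans inf_le_left, Filter.le_principal_iff.1 (hle.trans inf_le_right)⟩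

theorem eventually_ne_of_le_cofinite {U : Filter α} (hU : U ≤ Filter.cofinite) (a : α) :
    ∀ᶠ b in U, b ≠ a :=
  hU (Set.finite_singleton a).compl_mem_cofinite

end GenericSequences

section IdempotentUltrafilters

attribute [local instance] Ultrafilter.add

variable {M β : Type*} [AddCommMonoid M] {U : Ultrafilter M}

theorem eventually_iff_eventually_add (hU : U + U = U) {p : M → Prop} :
    (∀ᶠ a in U, p a) ↔ ∀ᶠ a in U, ∀ᶠ b in U, p (a + b) := by
  rw [← Ultrafilter.eventually_add, hU]

theorem eventually_map_eq_zero (hU : U + U = U) {G : Type*} [AddMonoid G] [IsLeftCancelAdd G]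
    [Finite G] (φ : M →+ G) : ∀ᶠ a in U, φ a = 0 := by
  obtain ⟨r, hr⟩ := (U.map φ).eq_pure_of_finite
  have hφ : ∀ᶠ a in U, φ a = r := by
    change {r} ∈ U.map φ
    rw [hr]
    exact rfl
  obtain ⟨a, ha, ha'⟩ := (hφ.and ((eventually_iff_eventually_add hU).1 hφ)).exists
  obtain ⟨b, hb, hb'⟩ := (hφ.and ha').exists
  have hr0 : r = 0 := by simpa only [map_add, ha, hb, _root_.add_eq_left] using hb'
  rwa [hr0] at hφ

theorem sum_attachFin {n : ℕ} {α : Finset ℕ} (hα : ∀ i ∈ α, i < n) (x : ℕ → M) :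
    ∑ i ∈ α.attachFin hα, x i = ∑ i ∈ α, x i := by
  conv_rhs => rw [← Finset.map_valEmbedding_attachFin hα, Finset.sum_map]
  rfl

theorem eventually_forall_sum_mem (hU : U + U = U) {S : ∀ n, (Fin n → M) → M → Prop}
    (hS : ∀ n h, ∀ᶠ a in U, S n h a) :
    ∀ᶠ x in seqAlong (U : Filter M), ∀ (n : ℕ) (α : Finset ℕ), α.Nonempty → (∀ i ∈ α, n ≤ i) →
      S n (fun i => x i) (∑ i ∈ α, x i) := by
  -- Galvin–Glazer: `star p` survives the addition of a further term, whereas `p` alone need not.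
  let star (p : M → Prop) (a : M) : Prop := p a ∧ ∀ᶠ b in U, p (a + b)
  have eventually_star {p : M → Prop} (hp : ∀ᶠ a in U, p a) : ∀ᶠ a in U, star p a :=
    hp.and ((eventually_iff_eventually_add hU).1 hp)
  have star_add {p : M → Prop} {a : M} (ha : star p a) : ∀ᶠ b in U, star p (a + b) := by
    simpa only [star, add_assoc] using eventually_star ha.2
  have hrule := eventually_seqAlong (U := (U : Filter M))
    (S := fun n h a => ∀ (m : Fin (n + 1)) (γ : Finset (Fin n)),
      (∀ᶠ b in U, star (S m fun i => h (i.castLE m.is_le)) (∑ i ∈ γ, h i + b)) →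
        star (S m fun i => h (i.castLE m.is_le)) (∑ i ∈ γ, h i + a))
    fun n h => Filter.eventually_all.2 fun m => Filter.eventually_all.2 fun γ =>
      eventually_imp_self _ _
  filter_upwards [hrule] with x hx n α hα hn
  suffices h : star (S n fun i => x i) (∑ i ∈ α, x i) from h.1
  induction α using Finset.induction_on_max with
  | empty => exact absurd hα Finset.not_nonempty_empty
  | insert b α hb ih =>
    rw [Finset.forall_mem_insert] at hn
    have hxb := hx b ⟨n, Nat.lt_succ_of_le hn.1⟩ (α.attachFin hb)
    rw [sum_attachFin hb x] at hxb
    rw [Finset.sum_insert fun h => (hb b h).false, add_comm]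
    apply hxb
    rcases α.eq_empty_or_nonempty with rfl | hα
    · simpa only [Finset.sum_empty, zero_add] using eventually_star (hS n _)
    · exact star_add (ih hα hn.2)

theorem eventually_forall_sum_sum_sum (hU : U + U = U) {q : M → M → M → Prop}
    (hq : ∀ s s', ∀ᶠ t in U, q s s' t) :
    ∀ᶠ x in seqAlong (U : Filter M), ∀ (n : ℕ) (γ δ β : Finset ℕ), β.Nonempty →
      (∀ i ∈ γ, i < n) → (∀ i ∈ δ, i < n) → (∀ i ∈ β, n ≤ i) →
        q (∑ i ∈ γ, x i) (∑ i ∈ δ, x i) (∑ i ∈ β, x i) := by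
  filter_upwards [eventually_forall_sum_mem hU
    (S := fun n h t => ∀ γ δ : Finset (Fin n), q (∑ i ∈ γ, h i) (∑ i ∈ δ, h i) t)
    fun n h => Filter.eventually_all.2 fun γ => Filter.eventually_all.2 fun δ => hq _ _]
    with x hx n γ δ β hβ hγ hδ hn
  simpa only [sum_attachFin _ x] using hx n β hβ hn (γ.attachFin hγ) (δ.attachFin hδ)

theorem eventually_forall_sum_sum (hU : U + U = U) {p : M → M → Prop}
    (hp : ∀ᶠ s in U, ∀ᶠ t in U, p s t) :
    ∀ᶠ x in seqAlong (U : Filter M), ∀ α β : Finset ℕ, α.Nonempty → β.Nonempty →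
      (∀ i ∈ α, ∀ j ∈ β, i < j) → p (∑ i ∈ α, x i) (∑ i ∈ β, x i) := by
  filter_upwards [eventually_forall_sum_mem hU (S := fun _ _ s => ∀ᶠ t in U, p s t) fun _ _ => hp,
    eventually_forall_sum_sum_sum hU (q := fun s _ t => (∀ᶠ t' in U, p s t') → p s t)
      fun s _ => eventually_imp_self _ _] with x hx hx' α β hα hβ hαβ
  refine hx' (β.min' hβ) α ∅ β hβ (fun i hi => hαβ i hi _ (β.min'_mem hβ))
    (fun i hi => absurd hi (Finset.notMem_empty i)) (fun j hj => β.min'_le j hj) ?_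
  exact hx 0 α hα fun i _ => i.zero_le

theorem eventually_forall_apply_sum_add_sum_ne (hU : U + U = U) {f R : M → β}
    (hf : ∀ᶠ s in U, ∀ v, ∀ᶠ t in U, f (s + t) ≠ v) :
    ∀ᶠ x in seqAlong (U : Filter M), ∀ (n : ℕ) (γ δ β : Finset ℕ), γ.Nonempty → β.Nonempty →
      (∀ i ∈ γ, i < n) → (∀ i ∈ δ, i < n) → (∀ i ∈ β, n ≤ i) →
        f (∑ i ∈ γ, x i + ∑ i ∈ β, x i) ≠ R (∑ i ∈ δ, x i) := by
  filter_upwards [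
    eventually_forall_sum_mem hU (S := fun _ _ s => ∀ v, ∀ᶠ t in U, f (s + t) ≠ v) fun _ _ => hf,
    eventually_forall_sum_sum_sum hU
      (q := fun s s' t => (∀ᶠ t' in U, f (s + t') ≠ R s') → f (s + t) ≠ R s')
      fun s s' => eventually_imp_self _ _] with x hx hx' n γ δ β hγ hβ hγn hδn hβn
  exact hx' n γ δ β hβ hγn hδn hβn (hx 0 γ hγ (fun i _ => i.zero_le) _)

end IdempotentUltrafilters

section NatIdempotents

attribute [local instance] Ultrafilter.add

theorem eventually_dvd {U : Ultrafilter ℕ} (hU : U + U = U) (N : ℕ) [NeZero N] :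
    ∀ᶠ n in U, N ∣ n := by
  filter_upwards [eventually_map_eq_zero hU (Nat.castAddMonoidHom (ZMod N))] with n hn
  exact (ZMod.natCast_eq_zero_iff n N).1 hn

theorem exists_sum_of_mem_hindmanFS {M : Type*} [AddCommMonoid M] (a : Stream' M) {m : M}
    (hm : m ∈ Hindman.FS a) : ∃ α : Finset ℕ, α.Nonempty ∧ ∑ i ∈ α, a.get i = m := by
  have sum_tail (b : Stream' M) (α : Finset ℕ) :
      ∑ i ∈ α.map (addRightEmbedding 1), b.get i = ∑ i ∈ α, b.tail.get i := by
    rw [Finset.sum_map]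
    rfl
  induction hm with
  | head' b => exact ⟨{0}, Finset.singleton_nonempty 0, Finset.sum_singleton _ _⟩
  | tail' b m _ ih =>
    obtain ⟨α, hα, rfl⟩ := ih
    exact ⟨_, hα.map, sum_tail b α⟩
  | cons' b m _ ih =>
    obtain ⟨α, -, rfl⟩ := ih
    refine ⟨insert 0 (α.map (addRightEmbedding 1)), Finset.insert_nonempty _ _, ?_⟩
    rw [Finset.sum_insert (by simp), sum_tail]

theorem sum_mem_finiteSums {x : ℕ → ℕ} (hx : Function.Injective x) {α : Finset ℕ}
    (hα : α.Nonempty) {F : Set ℕ} (hF : ∀ i ∈ α, x i ∈ F) : ∑ i ∈ α, x i ∈ finiteSums F :=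
  ⟨α.map ⟨x, hx⟩, hα.map, by simpa [Set.subset_def] using hF, by simp⟩

theorem exists_idempotent_finiteSums_mem {F : Set ℕ} (hF : F.Infinite) :
    ∃ U : Ultrafilter ℕ, U + U = U ∧ (U : Filter ℕ) ≤ Filter.cofinite ∧ finiteSums F ∈ U := by
  have hF₀ : (F \ {0}).Infinite := hF.sdiff (Set.finite_singleton 0)
  have := hF₀.to_subtype
  let e := Infinite.natEmbedding (F \ {0} : Set ℕ)
  obtain ⟨U, hUU, hU⟩ := Hindman.exists_idempotent_ultrafilter_le_FS
    (fun n => (e n : ℕ) : Stream' ℕ)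
  replace hUU : U + U = U := hUU
  have hpos : ∀ᶠ m in U, 0 < m ∧ m ∈ finiteSums F := by
    filter_upwards [hU] with m hm
    obtain ⟨α, hα, rfl⟩ := exists_sum_of_mem_hindmanFS _ hm
    exact ⟨Finset.sum_pos (fun i _ => Nat.pos_of_ne_zero (e i).2.2) hα,
      sum_mem_finiteSums (Subtype.val_injective.comp e.injective) hα fun i _ => (e i).2.1⟩
  refine ⟨U, hUU, U.le_cofinite_or_eq_pure.resolve_right ?_, hpos.mono fun _ h => h.2⟩
  rintro ⟨a, rfl⟩
  have ha : a + a = a := (eventually_iff_eventually_add (p := (· = a)) hUU).1 rfl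
  have ha₀ : 0 < a := hpos.1
  omega

end NatIdempotents

section PairsAndSums

/-- The unordered pair `{k, m}`; when `k = m` there is no such pair, and the value is `{0, 1}`. -/
def natPair (k m : ℕ) : NatPair :=
  if h : k ≠ m then ⟨{k, m}, Finset.card_pair h⟩ else ⟨{0, 1}, Finset.card_pair zero_ne_one⟩

theorem coe_natPair {k m : ℕ} (h : k ≠ m) : ((natPair k m : Finset ℕ) : Set ℕ) = {k, m} := by
  simp [natPair, h]

theorem exists_eq_natPair (P : NatPair) : ∃ k m, k < m ∧ P = natPair k m := by
  obtain ⟨P, hP⟩ := P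
  obtain ⟨a, b, hab, rfl⟩ := Finset.card_eq_two.1 hP
  rcases lt_or_gt_of_ne hab with h | h
  · exact ⟨a, b, h, by simp [natPair, h.ne]⟩
  · exact ⟨b, a, h, by simp [natPair, h.ne, Finset.pair_comm]⟩

theorem natPair_inj {k m k' m' : ℕ} (h : k < m) (h' : k' < m') :
    natPair k m = natPair k' m' ↔ k = k' ∧ m = m' := by
  refine ⟨fun heq => ?_, fun ⟨hk, hm⟩ => hk ▸ hm ▸ rfl⟩
  have hset : ({k, m} : Set ℕ) = {k', m'} := by rw [← coe_natPair h.ne, heq, coe_natPair h'.ne]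
  rcases Set.pair_eq_pair_iff.1 hset with hkm | hkm <;> omega

theorem natPair_mem_pairsOf {k m : ℕ} (h : k ≠ m) {F : Set ℕ} :
    natPair k m ∈ pairsOf F ↔ k ∈ F ∧ m ∈ F := by
  rw [pairsOf, Set.mem_ofPred_eq, coe_natPair h, Set.pair_subset_iff]

theorem mem_pairsOf_image {x : ℕ → ℕ} (hx : StrictMono x) {S : Set ℕ} {P : NatPair} :
    P ∈ pairsOf (x '' S) ↔ ∃ i ∈ S, ∃ j ∈ S, i < j ∧ natPair (x i) (x j) = P := by
  constructor
  · obtain ⟨k, m, hkm, rfl⟩ := exists_eq_natPair P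
    intro hP
    obtain ⟨⟨i, hi, rfl⟩, ⟨j, hj, rfl⟩⟩ := (natPair_mem_pairsOf hkm.ne).1 hP
    exact ⟨i, hi, j, hj, hx.lt_iff_lt.1 hkm, rfl⟩
  · rintro ⟨i, hi, j, hj, hij, rfl⟩
    exact (natPair_mem_pairsOf (hx hij).ne).2 ⟨Set.mem_image_of_mem x hi, Set.mem_image_of_mem x hj⟩

theorem infinite_pairsOf {F : Set ℕ} (hF : F.Infinite) : (pairsOf F).Infinite := by
  intro hfin
  refine hF ((hfin.biUnion fun P _ => P.1.finite_toSet).subset fun a ha => ?_)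
  obtain ⟨b, hb, hab⟩ := hF.exists_gt a
  refine Set.mem_biUnion ((natPair_mem_pairsOf hab.ne).2 ⟨ha, hb⟩) ?_
  rw [coe_natPair hab.ne]
  exact Set.mem_insert a {b}

theorem mem_finiteSums_image {x : ℕ → ℕ} (hx : Function.Injective x) {S : Set ℕ} {m : ℕ} :
    m ∈ finiteSums (x '' S) ↔
      ∃ α : Finset ℕ, α.Nonempty ∧ (∀ i ∈ α, i ∈ S) ∧ ∑ i ∈ α, x i = m := by
  classical
  constructor
  · rintro ⟨β, hβ, hβS, rfl⟩
    obtain ⟨α, hα, rfl⟩ := Finset.subset_set_image_iff.1 hβS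
    exact ⟨α, Finset.image_nonempty.1 hβ, hα, (Finset.sum_image (f := fun i => i) hx.injOn).symm⟩
  · rintro ⟨α, hα, hαS, rfl⟩
    exact sum_mem_finiteSums hx hα fun i hi => Set.mem_image_of_mem x (hαS i hi)

theorem range_sdiff_image_range {β : Type*} [DecidableEq β] {x : ℕ → β} (hx : Function.Injective x)
    (n : ℕ) : Set.range x \ ((Finset.range n).image x : Finset β) = x '' Set.Ici n := by
  rw [Finset.coe_image, ← Set.image_univ, ← Set.image_sdiff hx, Finset.coe_range,
    ← Set.compl_eq_univ_sdiff, Set.compl_Iio]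

theorem finiteSums_mono : Monotone finiteSums :=
  fun _ _ h _ ⟨α, hα, hαE, hm⟩ => ⟨α, hα, hαE.trans h, hm⟩

theorem subset_finiteSums (F : Set ℕ) : F ⊆ finiteSums F := fun n hn =>
  ⟨{n}, Finset.singleton_nonempty n, by simpa using hn, (Finset.sum_singleton (fun i => i) n).symm⟩

theorem tailFilter_range_le {Λ : Type*} {ρ : Set ℕ → Set Λ} (hρ : Monotone ρ) {x : ℕ → ℕ}
    (hx : Function.Injective x) {G : Filter Λ} {A : ℕ → Set Λ} (hA : G.HasAntitoneBasis A)
    (hxA : ∀ n, ρ (x '' Set.Ici n) ⊆ A n) : tailFilter ρ (Set.range x) ≤ G := by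
  refine hA.1.ge_iff.2 fun n _ => (mem_tailFilter hρ).2 ⟨(Finset.range n).image x, ?_⟩
  rw [range_sdiff_image_range hx]
  exact hxA n

theorem pairsOf_mono : Monotone pairsOf :=
  fun _ _ h _ hP => Set.Subset.trans hP h

theorem isRhoPoint_pairsOf_bind {U : Ultrafilter ℕ} (hU : (U : Filter ℕ) ≤ Filter.cofinite) :
    IsRhoPoint pairsOf (U.bind fun k => U.map (natPair k)) := by
  intro G _ hG
  obtain ⟨A, hA⟩ := G.exists_antitone_basis
  have hmem (n : ℕ) : ∀ᶠ k in U, ∀ᶠ m in U, natPair k m ∈ A n := hG (hA.1.mem_of_mem trivial)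
  obtain ⟨x, hx, hxA⟩ := ((eventually_strictMono hU).and (eventually_forall_lt hmem)).exists
  refine ⟨_, Set.infinite_range_of_injective hx.injective,
    tailFilter_range_le pairsOf_mono hx.injective hA fun n P hP => ?_⟩
  obtain ⟨i, hi, j, -, hij, rfl⟩ := (mem_pairsOf_image hx).1 hP
  exact hA.2 hi (hxA i j hij)

theorem isPRegular_pairsOf : IsPRegular pairsOf where
  mono := pairsOf_mono
  infinite _ := infinite_pairsOf
  exists_point F hF := by
    obtain ⟨U, hU, hFU⟩ := exists_ultrafilter_le_cofinite hF
    refine ⟨_, ?_, isRhoPoint_pairsOf_bind hU⟩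
    change ∀ᶠ k in U, ∀ᶠ m in U, natPair k m ∈ pairsOf F
    filter_upwards [hFU] with k hk
    filter_upwards [hFU, eventually_ne_of_le_cofinite hU k] with m hm hmk
    exact (natPair_mem_pairsOf hmk.symm).2 ⟨hk, hm⟩

attribute [local instance] Ultrafilter.add in
theorem isRhoPoint_finiteSums {U : Ultrafilter ℕ} (hUU : U + U = U)
    (hU : (U : Filter ℕ) ≤ Filter.cofinite) : IsRhoPoint finiteSums U := by
  intro G _ hG
  obtain ⟨A, hA⟩ := G.exists_antitone_basis
  obtain ⟨x, hx, hxA⟩ := ((eventually_strictMono hU).and (eventually_forall_sum_mem hUU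
    (S := fun n _ m => m ∈ A n) fun n _ => hG (hA.1.mem_of_mem trivial))).exists
  refine ⟨_, Set.infinite_range_of_injective hx.injective,
    tailFilter_range_le finiteSums_mono hx.injective hA fun n m hm => ?_⟩
  obtain ⟨α, hα, hαn, rfl⟩ := (mem_finiteSums_image hx.injective).1 hm
  exact hxA n α hα hαn

theorem isPRegular_finiteSums : IsPRegular finiteSums where
  mono := finiteSums_mono
  infinite F hF := hF.mono (subset_finiteSums F)
  exists_point F hF := by
    obtain ⟨U, hUU, hU, hFU⟩ := exists_idempotent_finiteSums_mem hF
    exact ⟨U, hFU, isRhoPoint_finiteSums hUU hU⟩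

end PairsAndSums

section ImagesOfPairs

theorem padicValNat_add_of_dvd {p : ℕ} [Fact p.Prime] {a b : ℕ} (ha : a ≠ 0)
    (h : p ^ (padicValNat p a + 1) ∣ b) : padicValNat p (a + b) = padicValNat p a := by
  have hab : a + b ≠ 0 := by omega
  refine le_antisymm (Nat.le_of_not_lt fun hlt => ?_) ?_
  · have hdvd := (padicValNat_dvd_iff_le hab).2 (Nat.succ_le_of_lt hlt)
    have hle := (padicValNat_dvd_iff_le ha).1 ((Nat.dvd_add_left h).1 hdvd)
    omega
  · refine (padicValNat_dvd_iff_le hab).1 (dvd_add pow_padicValNat_dvd ?_)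
    exact (pow_dvd_pow p (Nat.le_succ _)).trans h

theorem exists_strictMono_sum_mem_finiteSums (p : ℕ) [Fact p.Prime] {E : Set ℕ}
    (hE : E.Infinite) :
    ∃ e : ℕ → ℕ, StrictMono e ∧ (∀ i, e i ≠ 0) ∧
      (∀ i j, i < j → p ^ (padicValNat p (e i) + 1) ∣ e j) ∧
        ∀ α : Finset ℕ, α.Nonempty → ∑ i ∈ α, e i ∈ finiteSums E := by
  obtain ⟨U, hUU, hU, hEU⟩ := exists_idempotent_finiteSums_mem hE
  have hpow (k : ℕ) : NeZero (p ^ k) := ⟨pow_ne_zero _ (Fact.out : p.Prime).ne_zero⟩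
  obtain ⟨e, hmono, hne, hdvd, hsum⟩ := ((eventually_strictMono hU).and
    ((eventually_seqAlong fun _ _ => eventually_ne_of_le_cofinite hU 0).and
      ((eventually_forall_lt (p := fun _ a b => p ^ (padicValNat p a + 1) ∣ b)
        fun _ => Filter.Eventually.of_forall fun a => eventually_dvd hUU _).and
          (eventually_forall_sum_mem hUU (S := fun _ _ m => m ∈ finiteSums E)
            fun _ _ => hEU)))).exists
  exact ⟨e, hmono, hne, hdvd, fun α hα => hsum 0 α hα fun i _ => i.zero_le⟩

theorem rhoSmall_finiteSums_of_padicValNat_eq (p : ℕ) [Fact p.Prime] {C : Set ℕ} {d : ℕ}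
    (hC : ∀ n ∈ C, padicValNat p n = d) : RhoSmall finiteSums C := by
  intro E hE hEC
  obtain ⟨e, -, he, hdvd, hsum⟩ := exists_strictMono_sum_mem_finiteSums p hE
  have hval (i : ℕ) : padicValNat p (e i) = d :=
    hC _ (hEC (by simpa using hsum {i} (Finset.singleton_nonempty i)))
  have hlt := (padicValNat_dvd_iff_le (he 1)).1 (hdvd 0 1 zero_lt_one)
  rw [hval, hval] at hlt
  omega

theorem rhoSmall_finiteSums_of_padicValNat_fibres (p : ℕ) [Fact p.Prime] {C : Set ℕ}
    (hC : ∀ d, {n ∈ C | padicValNat p n = d}.Finite ∨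
      ∀ w ∈ C, ∀ z ∈ C, padicValNat p w = d → padicValNat p z = d → w < z → 2 * w < z) :
    RhoSmall finiteSums C := by
  intro E hE hEC
  obtain ⟨e, hmono, he, hdvd, hsum⟩ := exists_strictMono_sum_mem_finiteSums p hE
  have hsum₂ (k : ℕ) : e 0 + e (k + 1) ∈ C := hEC (by simpa using hsum {0, k + 1} (by simp))
  have hval (k : ℕ) : padicValNat p (e 0 + e (k + 1)) = padicValNat p (e 0) :=
    padicValNat_add_of_dvd (he 0) (hdvd 0 (k + 1) k.succ_pos)
  rcases hC (padicValNat p (e 0)) with hfin | hlac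
  · refine Set.infinite_of_injective_forall_mem (f := fun k => e 0 + e (k + 1)) ?_
      (fun k => And.intro (hsum₂ k) (hval k)) hfin
    exact fun k l hkl => Nat.succ_injective (hmono.injective (Nat.add_left_cancel hkl))
  · have hsum₃ : e 0 + (e 1 + e 2) ∈ C := hEC (by simpa using hsum {0, 1, 2} (by simp))
    have hval₃ : padicValNat p (e 0 + (e 1 + e 2)) = padicValNat p (e 0) :=
      padicValNat_add_of_dvd (he 0) (dvd_add (hdvd 0 1 zero_lt_one) (hdvd 0 2 zero_lt_two))
    have hpos : 0 < e 1 := Nat.pos_of_ne_zero (he 1)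
    have hlt : e 1 < e 2 := hmono one_lt_two
    have hgap : 2 * (e 0 + e 2) < e 0 + (e 1 + e 2) :=
      hlac _ (hsum₂ 1) _ hsum₃ (hval 1) hval₃ (Nat.add_lt_add_left (Nat.lt_add_of_pos_left hpos) _)
    omega

theorem eventually_lt_apply_of_forall_ne {α : Type*} {U : Filter α} {f : α → ℕ}
    (hf : ∀ v, ∀ᶠ a in U, f a ≠ v) (N : ℕ) : ∀ᶠ a in U, N < f a := by
  filter_upwards [(Set.finite_Iic N).eventually_all.2 fun v _ => hf v] with a ha
  exact lt_of_not_ge fun h => ha _ h rfl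

theorem eventually_eq_or_lacunary {α : Type*} (U : Ultrafilter α) (f : α → ℕ) :
    ∀ᶠ a in U, ∀ᶠ b in U, f a = f b ∨ 2 * f a < f b := by
  rcases eventually_const_or_forall_eventually_ne U f with ⟨v, hv⟩ | hne
  · filter_upwards [hv] with a ha
    filter_upwards [hv] with b hb using Or.inl (ha.trans hb.symm)
  · refine Filter.Eventually.of_forall fun a => ?_
    exact (eventually_lt_apply_of_forall_ne hne _).mono fun b => Or.inr

theorem eventually_rhoSmall_finiteSums {α : Type*} (U : Ultrafilter α) (b : α → α → ℕ) :
    ∀ᶠ x in seqAlong (U : Filter α),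
      RhoSmall finiteSums {m | ∃ i j, i < j ∧ b (x i) (x j) = m} := by
  rcases eventually_left_or_forall_eventually_ne U fun k m => padicValNat 2 (b k m) with
    ⟨L, hL⟩ | hne
  · rcases eventually_const_or_forall_eventually_ne U L with ⟨d, hd⟩ | hinj
    · have hconst : ∀ᶠ k in U, ∀ᶠ m in U, padicValNat 2 (b k m) = d := by
        filter_upwards [hL, hd] with k hk hkd using hkd ▸ hk
      filter_upwards [eventually_forall_lt fun _ => hconst] with x hx
      refine rhoSmall_finiteSums_of_padicValNat_eq 2 (d := d) ?_
      rintro _ ⟨i, j, hij, rfl⟩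
      exact hx i j hij
    · filter_upwards [eventually_forall_lt fun _ => hL, eventually_injective_comp hinj,
        eventually_forall_lt_lt (Filter.Eventually.of_forall fun k =>
          eventually_eq_or_lacunary U (b k))] with x hx hinj hlac
      refine rhoSmall_finiteSums_of_padicValNat_fibres 2 fun d => Or.inr ?_
      rintro _ ⟨i, j, hij, rfl⟩ _ ⟨i', l, hil, rfl⟩ hw hz hwz
      obtain rfl : i = i' := hinj ((hx i j hij).symm.trans (hw.trans (hz.symm.trans (hx i' l hil))))
      rcases lt_trichotomy j l with hjl | rfl | hlj
      · exact (hlac i j l hij hjl).resolve_left hwz.ne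
      · exact absurd hwz (lt_irrefl _)
      · have := hlac i l j hil hlj
        omega
  · filter_upwards [eventually_eq_of_apply_eq hne] with x hx
    refine rhoSmall_finiteSums_of_padicValNat_fibres 2 fun d => Or.inl ?_
    rcases Set.eq_empty_or_nonempty
      {m | (∃ i j, i < j ∧ b (x i) (x j) = m) ∧ padicValNat 2 m = d} with hempty | ⟨_, hm⟩
    · exact hempty ▸ Set.finite_empty
    · obtain ⟨⟨i₀, j₀, hij₀, rfl⟩, hd₀⟩ := hm
      refine ((Set.finite_Iio j₀).image fun i => b (x i) (x j₀)).subset ?_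
      rintro _ ⟨⟨i, j, hij, rfl⟩, hd⟩
      obtain rfl := hx i j i₀ j₀ hij hij₀ (hd.trans hd₀.symm)
      exact Set.mem_image_of_mem _ hij

theorem exists_rhoSmall_finiteSums_image_pairsOf (g : NatPair → ℕ) :
    ∃ F : Set ℕ, F.Infinite ∧ RhoSmall finiteSums (g '' pairsOf F) := by
  obtain ⟨U, hU, -⟩ := exists_ultrafilter_le_cofinite (Set.infinite_univ (α := ℕ))
  obtain ⟨x, hx, hsmall⟩ := ((eventually_strictMono hU).and
    (eventually_rhoSmall_finiteSums U fun k m => g (natPair k m))).exists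
  refine ⟨_, (Set.infinite_univ (α := ℕ)).image hx.injective.injOn, hsmall.mono ?_⟩
  rintro _ ⟨P, hP, rfl⟩
  obtain ⟨i, -, j, -, hij, rfl⟩ := (mem_pairsOf_image hx).1 hP
  exact ⟨i, j, hij, rfl⟩

end ImagesOfPairs

section ImagesOfSums

attribute [local instance] Ultrafilter.add

variable {M β : Type*} [AddCommMonoid M] {U : Ultrafilter M}

theorem eventually_apply_sum_eq_of_isLeast (hU : U + U = U) {f P : M → β}
    (hP : ∀ᶠ s in U, ∀ᶠ t in U, f (s + t) = P s) :
    ∀ᶠ x in seqAlong (U : Filter M), ∀ (α : Finset ℕ) (i : ℕ), α.Nontrivial →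
      IsLeast (α : Set ℕ) i → f (∑ l ∈ α, x l) = P (x i) := by
  filter_upwards [eventually_forall_sum_sum hU hP] with x hx α i hα hi
  rw [← Finset.add_sum_erase α x hi.1]
  simpa using hx {i} (α.erase i) (Finset.singleton_nonempty i) (hα.erase_nonempty) (by
    simpa using fun l hli hl => lt_of_le_of_ne (hi.2 hl) (Ne.symm hli))

theorem eventually_apply_sum_ne_of_isGreatest (hU : U + U = U) (R : M → β) {f : M → β}
    (hf : ∀ᶠ s in U, ∀ v, ∀ᶠ t in U, f (s + t) ≠ v) :
    ∀ᶠ x in seqAlong (U : Filter M), ∀ (α δ : Finset ℕ) (j : ℕ), α.Nontrivial →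
      IsGreatest (α : Set ℕ) j → (∀ l ∈ δ, l < j) → f (∑ l ∈ α, x l) ≠ R (∑ l ∈ δ, x l) := by
  filter_upwards [eventually_forall_apply_sum_add_sum_ne hU (R := R) hf] with x hx α δ j hα hj hδ
  rw [← Finset.sum_erase_add α x hj.1]
  simpa using hx j (α.erase j) δ {j} hα.erase_nonempty (Finset.singleton_nonempty j)
    (by simpa using fun l hlj hl => lt_of_le_of_ne (hj.2 hl) hlj) hδ (by simp)

theorem eventually_apply_ne_apply_sum {U : Filter M} (R : M → β) {P : M → β}
    (hP : ∀ v, ∀ᶠ s in U, P s ≠ v) :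
    ∀ᶠ x in seqAlong U, ∀ (i : ℕ) (δ : Finset ℕ), (∀ l ∈ δ, l < i) →
      P (x i) ≠ R (∑ l ∈ δ, x l) := by
  filter_upwards [eventually_seqAlong (U := U)
    (S := fun n h a => ∀ δ : Finset (Fin n), P a ≠ R (∑ l ∈ δ, h l))
    fun n h => Filter.eventually_all.2 fun δ => hP _] with x hx i δ hδ
  simpa only [sum_attachFin hδ x] using hx i (δ.attachFin hδ)

/-- `α` has an even least element `i` and an odd greatest element `j`. The parities ensure that the
least element of one such set is never the greatest element of another. -/
structure IsEvenOddSpan (α : Finset ℕ) (i j : ℕ) : Prop where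
  isLeast : IsLeast (α : Set ℕ) i
  even : Even i
  isGreatest : IsGreatest (α : Set ℕ) j
  odd : Odd j

theorem IsEvenOddSpan.nontrivial {α : Finset ℕ} {i j : ℕ} (h : IsEvenOddSpan α i j) :
    α.Nontrivial :=
  ⟨i, h.isLeast.1, j, h.isGreatest.1, fun hij => Nat.not_even_iff_odd.2 h.odd (hij ▸ h.even)⟩

/-- For no infinite `E` is every pair `a < b` of elements of `E` of the form `(p s, q s)` with `s` a
sum of terms of `x` over an even-odd span. -/
def OmitsPairs (p q : M → ℕ) (x : ℕ → M) : Prop :=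
  ∀ E : Set ℕ, E.Infinite → ¬ ∀ a ∈ E, ∀ b ∈ E, a < b →
    ∃ α i j, IsEvenOddSpan α i j ∧ p (∑ l ∈ α, x l) = a ∧ q (∑ l ∈ α, x l) = b

theorem exists_mem_lt_lt {E : Set ℕ} (hE : E.Infinite) :
    ∃ a ∈ E, ∃ b ∈ E, ∃ c ∈ E, a < b ∧ b < c := by
  obtain ⟨a, ha⟩ := hE.nonempty
  obtain ⟨b, hb, hab⟩ := hE.exists_gt a
  obtain ⟨c, hc, hbc⟩ := hE.exists_gt b
  exact ⟨a, ha, b, hb, c, hc, hab, hbc⟩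

theorem eventually_omitsPairs_of_left_ne (hU : U + U = U) {p : M → ℕ} (q : M → ℕ)
    (hp : ∀ᶠ s in U, ∀ v, ∀ᶠ t in U, p (s + t) ≠ v) :
    ∀ᶠ x in seqAlong (U : Filter M), OmitsPairs p q x := by
  filter_upwards [eventually_apply_sum_ne_of_isGreatest hU p hp] with x hx E hE hrep
  obtain ⟨a, ha⟩ := hE.nonempty
  obtain ⟨b₀, hb₀, hab₀⟩ := hE.exists_gt a
  choose! α i j hα hpα hqα using hrep a ha
  have hEa : (E \ Set.Iic a).Infinite := hE.sdiff (Set.finite_Iic a)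
  have hinj : Set.InjOn α (E \ Set.Iic a) := by
    rintro b ⟨hb, hab⟩ c ⟨hc, hac⟩ hbc
    rw [← hqα b hb (not_le.1 hab), ← hqα c hc (not_le.1 hac), hbc]
  refine hEa.image hinj ((Finset.range (j b₀ + 1)).powerset.finite_toSet.subset ?_)
  rintro _ ⟨b, ⟨hb, hab⟩, rfl⟩
  have hab : a < b := not_le.1 hab
  have hj : j b ≤ j b₀ := by
    by_contra! hlt
    exact hx (α b) (α b₀) (j b) (hα b hb hab).nontrivial (hα b hb hab).isGreatest
      (fun l hl => ((hα b₀ hb₀ hab₀).isGreatest.2 hl).trans_lt hlt)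
      ((hpα b hb hab).trans (hpα b₀ hb₀ hab₀).symm)
  refine Finset.mem_coe.2 (Finset.mem_powerset.2 fun l hl => Finset.mem_range.2 ?_)
  exact Nat.lt_succ_of_le (((hα b hb hab).isGreatest.2 hl).trans hj)

theorem eventually_omitsPairs_of_left_const (hU : U + U = U) {p P : M → ℕ} (q : M → ℕ)
    (hP : ∀ᶠ s in U, ∀ᶠ t in U, p (s + t) = P s) {v : ℕ} (hv : ∀ᶠ s in U, P s = v) :
    ∀ᶠ x in seqAlong (U : Filter M), OmitsPairs p q x := by
  have hpv : ∀ᶠ s in U, ∀ᶠ t in U, p (s + t) = v := by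
    filter_upwards [hP, hv] with s hs hsv using hsv ▸ hs
  filter_upwards [eventually_apply_sum_eq_of_isLeast hU (P := fun _ => v) hpv] with x hx E hE hrep
  obtain ⟨a, ha, b, hb, c, hc, hab, hbc⟩ := exists_mem_lt_lt hE
  obtain ⟨α, i, j, hα, rfl, -⟩ := hrep a ha b hb hab
  obtain ⟨α', i', j', hα', rfl, -⟩ := hrep _ hb c hc hbc
  rw [hx α i hα.nontrivial hα.isLeast, hx α' i' hα'.nontrivial hα'.isLeast] at hab
  exact hab.false

theorem eventually_omitsPairs_of_right_ne (hU : U + U = U) {p q P : M → ℕ}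
    (hP : ∀ᶠ s in U, ∀ᶠ t in U, p (s + t) = P s) (hPne : ∀ v, ∀ᶠ s in U, P s ≠ v)
    (hq : ∀ᶠ s in U, ∀ v, ∀ᶠ t in U, q (s + t) ≠ v) :
    ∀ᶠ x in seqAlong (U : Filter M), OmitsPairs p q x := by
  filter_upwards [eventually_apply_sum_eq_of_isLeast hU hP, eventually_apply_ne_apply_sum q hPne,
    eventually_apply_sum_ne_of_isGreatest hU P hq] with x hpx hPx hqx E hE hrep
  obtain ⟨a, ha, b, hb, c, hc, hab, hbc⟩ := exists_mem_lt_lt hE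
  obtain ⟨α, i₀, j, hα, -, hqα⟩ := hrep a ha b hb hab
  obtain ⟨α', i, j₀, hα', hpα', -⟩ := hrep b hb c hc hbc
  have hPi : P (x i) = q (∑ l ∈ α, x l) := by
    rw [← hpx α' i hα'.nontrivial hα'.isLeast, hpα', hqα]
  rcases lt_trichotomy i j with hij | rfl | hji
  · refine hqx α {i} j hα.nontrivial hα.isGreatest (by simpa using hij) ?_
    rw [Finset.sum_singleton, hPi]
  · exact Nat.not_even_iff_odd.2 hα.odd hα'.even
  · exact hPx i α (fun l hl => (hα.isGreatest.2 hl).trans_lt hji) hPi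

theorem eventually_omitsPairs_of_right_eq (hU : U + U = U) {p q P Q : M → ℕ}
    (hP : ∀ᶠ s in U, ∀ᶠ t in U, p (s + t) = P s) (hPne : ∀ v, ∀ᶠ s in U, P s ≠ v)
    (hQ : ∀ᶠ s in U, ∀ᶠ t in U, q (s + t) = Q s) :
    ∀ᶠ x in seqAlong (U : Filter M), OmitsPairs p q x := by
  filter_upwards [eventually_apply_sum_eq_of_isLeast hU hP, eventually_injective_comp hPne,
    eventually_apply_sum_eq_of_isLeast hU hQ] with x hpx hPx hqx E hE hrep
  obtain ⟨a, ha, b, hb, c, hc, hab, hbc⟩ := exists_mem_lt_lt hE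
  obtain ⟨α, i, j, hα, hpα, rfl⟩ := hrep a ha b hb hab
  obtain ⟨α', i', j', hα', hpα', rfl⟩ := hrep a ha c hc (hab.trans hbc)
  rw [hpx α i hα.nontrivial hα.isLeast] at hpα
  rw [hpx α' i' hα'.nontrivial hα'.isLeast] at hpα'
  obtain rfl : i = i' := hPx (hpα.trans hpα'.symm)
  rw [hqx α i hα.nontrivial hα.isLeast, hqx α' i hα'.nontrivial hα'.isLeast] at hbc
  exact hbc.false

theorem eventually_omitsPairs (hU : U + U = U) (p q : M → ℕ) :
    ∀ᶠ x in seqAlong (U : Filter M), OmitsPairs p q x := by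
  rcases eventually_left_or_forall_eventually_ne U fun s t => p (s + t) with ⟨P, hP⟩ | hp
  · rcases eventually_const_or_forall_eventually_ne U P with ⟨v, hv⟩ | hPne
    · exact eventually_omitsPairs_of_left_const hU q hP hv
    · rcases eventually_left_or_forall_eventually_ne U fun s t => q (s + t) with ⟨Q, hQ⟩ | hq
      · exact eventually_omitsPairs_of_right_eq hU hP hPne hQ
      · exact eventually_omitsPairs_of_right_ne hU hP hPne hq
  · exact eventually_omitsPairs_of_left_ne hU q hp

theorem exists_isEvenOddSpan_sum_eq {β : Finset ℕ} (hβ : β.Nonempty) (x : ℕ → M) :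
    ∃ α i j, IsEvenOddSpan α i j ∧ ∑ l ∈ α, x l = ∑ n ∈ β, (x (2 * n) + x (2 * n + 1)) := by
  have hdisj : Disjoint (β.image (2 * ·)) (β.image (2 * · + 1)) := by
    simp only [Finset.disjoint_left, Finset.mem_image]
    rintro _ ⟨n, -, rfl⟩ ⟨m, -, hm⟩
    omega
  refine ⟨β.image (2 * ·) ∪ β.image (2 * · + 1), 2 * β.min' hβ, 2 * β.max' hβ + 1,
    ⟨⟨?_, ?_⟩, even_two_mul _, ⟨?_, ?_⟩, odd_two_mul_add_one _⟩, ?_⟩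
  · exact Finset.mem_union_left _ (Finset.mem_image_of_mem _ (β.min'_mem hβ))
  · simp only [lowerBounds, Finset.coe_union, Finset.coe_image]
    rintro _ (⟨n, hn, rfl⟩ | ⟨n, hn, rfl⟩) <;> grind [β.min'_le n hn]
  · exact Finset.mem_union_right _ (Finset.mem_image_of_mem _ (β.max'_mem hβ))
  · simp only [upperBounds, Finset.coe_union, Finset.coe_image]
    rintro _ (⟨n, hn, rfl⟩ | ⟨n, hn, rfl⟩) <;> grind [β.le_max' n hn]
  · rw [Finset.sum_union hdisj, Finset.sum_image (by simp), Finset.sum_image (by simp),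
      Finset.sum_add_distrib]

theorem exists_rhoSmall_pairsOf_image_finiteSums (g : ℕ → NatPair) :
    ∃ F : Set ℕ, F.Infinite ∧ RhoSmall pairsOf (g '' finiteSums F) := by
  choose p q hpq hg using fun n => exists_eq_natPair (g n)
  obtain ⟨U, hUU, hU, -⟩ := exists_idempotent_finiteSums_mem (Set.infinite_univ (α := ℕ))
  obtain ⟨x, hx, homits⟩ := ((eventually_strictMono hU).and (eventually_omitsPairs hUU p q)).exists
  have hblocks : StrictMono fun n => x (2 * n) + x (2 * n + 1) := fun n m hnm =>
    add_lt_add (hx (by omega)) (hx (by omega))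
  refine ⟨_, (Set.infinite_univ (α := ℕ)).image hblocks.injective.injOn, fun E hE hsub => ?_⟩
  refine homits E hE fun a ha b hb hab => ?_
  obtain ⟨m, hm, hgm⟩ := hsub ((natPair_mem_pairsOf hab.ne).2 ⟨ha, hb⟩)
  obtain ⟨β, hβ, -, rfl⟩ := (mem_finiteSums_image hblocks.injective).1 hm
  obtain ⟨α, i, j, hα, hsum⟩ := exists_isEvenOddSpan_sum_eq hβ x
  rw [← hsum, hg, natPair_inj (hpq _) hab] at hgm
  exact ⟨α, i, j, hα, hgm⟩

end ImagesOfSums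

section Relations

variable {X : Type*} [TopologicalSpace X]

theorem IsRamseySpace.isDifferentiallyCompact (h : IsRamseySpace X) :
    IsDifferentiallyCompact X := by
  choose k m hkm hp using exists_eq_natPair
  refine FinBW.of_subset_image (fun p => m p - k p) (fun F hF => ⟨F, hF, fun K => ⟨K, ?_⟩⟩) h
  rintro _ ⟨a, ha, b, hb, hba, rfl⟩
  obtain ⟨hbk, ham⟩ := (natPair_inj hba (hkm _)).1 (hp (natPair b a))
  exact ⟨natPair b a, (natPair_mem_pairsOf hba.ne).2 ⟨hb, ha⟩, congrArg₂ (· - ·) ham.symm hbk.symm⟩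

theorem strictMono_sum_range {x : ℕ → ℕ} (hx : ∀ n, 0 < x n) :
    StrictMono fun n => ∑ i ∈ Finset.range n, x i :=
  strictMono_nat_of_lt_succ fun n => by
    simpa only [Finset.sum_range_succ] using Nat.lt_add_of_pos_right (hx n)

theorem IsHindmanSpace.isDifferentiallyCompact (h : IsHindmanSpace X) :
    IsDifferentiallyCompact X := by
  refine FinBW.of_subset_image id (fun F hF => ?_) h
  have : Infinite (F \ {0} : Set ℕ) := (hF.sdiff (Set.finite_singleton 0)).to_subtype
  let e := Infinite.natEmbedding (F \ {0} : Set ℕ)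
  have he : Function.Injective fun n => (e n : ℕ) := Subtype.val_injective.comp e.injective
  have hs : StrictMono fun n => ∑ i ∈ Finset.range n, (e i : ℕ) :=
    strictMono_sum_range fun n => Nat.pos_of_ne_zero (e n).2.2
  refine ⟨_, Set.infinite_range_of_injective hs.injective, fun K => ?_⟩
  obtain ⟨N, hN⟩ : ∃ N, ∀ n, N ≤ n → (e n : ℕ) ∉ K := by
    simpa only [Finset.mem_coe, Filter.eventually_cofinite, Nat.cofinite_eq_atTop,
      Filter.eventually_atTop] using
      he.tendsto_cofinite.eventually K.finite_toSet.eventually_cofinite_notMem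
  refine ⟨(Finset.range N).image fun n => ∑ i ∈ Finset.range n, (e i : ℕ), ?_⟩
  rw [range_sdiff_image_range hs.injective, Set.image_id]
  rintro _ ⟨_, ⟨a, -, rfl⟩, _, ⟨b, hb, rfl⟩, hlt, rfl⟩
  have hba : b < a := hs.lt_iff_lt.1 hlt
  beta_reduce
  rw [← Finset.sum_range_add_sum_Ico _ hba.le, Nat.add_sub_cancel_left]
  exact sum_mem_finiteSums he (Finset.nonempty_Ico.2 hba) fun i hi =>
    ⟨(e i).2.1, hN i (hb.trans (Finset.mem_Ico.1 hi).1)⟩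

end Relations

theorem mainTheorem4 (CH : Cardinal.continuum.{0} = Cardinal.aleph.{0} 1) :
    (∃ 𝒜 : Set (Set ℕ), IsGoodFamily 𝒜 ∧
      IsRamseySpace (Phi 𝒜) ∧ ¬ IsHindmanSpace (Phi 𝒜)) ∧
    (∃ 𝒜 : Set (Set ℕ), IsGoodFamily 𝒜 ∧
      IsHindmanSpace (Phi 𝒜) ∧ ¬ IsRamseySpace (Phi 𝒜)) ∧
    (∃ 𝒜 : Set (Set ℕ), IsGoodFamily 𝒜 ∧
      IsDifferentiallyCompact (Phi 𝒜) ∧ ¬ IsHindmanSpace (Phi 𝒜)) ∧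
    (∃ 𝒜 : Set (Set ℕ), IsGoodFamily 𝒜 ∧
      IsDifferentiallyCompact (Phi 𝒜) ∧ ¬ IsRamseySpace (Phi 𝒜)) := by
  obtain ⟨𝒜, h𝒜, hRamsey, hHindman⟩ := exists_isGoodFamily_finBW_not_finBW CH
    isPRegular_pairsOf isPRegular_finiteSums exists_rhoSmall_finiteSums_image_pairsOf
  obtain ⟨ℬ, hℬ, hHindman', hRamsey'⟩ := exists_isGoodFamily_finBW_not_finBW CH
    isPRegular_finiteSums isPRegular_pairsOf exists_rhoSmall_pairsOf_image_finiteSums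
  exact ⟨⟨𝒜, h𝒜, hRamsey, hHindman⟩, ⟨ℬ, hℬ, hHindman', hRamsey'⟩,
    ⟨𝒜, h𝒜, IsRamseySpace.isDifferentiallyCompact hRamsey, hHindman⟩,
    ⟨ℬ, hℬ, IsHindmanSpace.isDifferentiallyCompact hHindman', hRamsey'⟩⟩
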